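/- **Theorem 1.2 (Strong Maximum Principle).** Let $\Omega\subset\mathbb R^n$ be a connected open set and let $X_1,\dots,X_m$ be smooth vector fields in $\mathbb R^n$ satisfying Hörmander's finite rank condition $\operatorname{rank}\,\mathrm{Lie}[X_1,\dots,X_m](x)=n$ for all $x\in\Omega$. Write $Xu=(X_1u,\dots,X_mu)$ and let $X_j^*$ be the $L^2$ adjoint of $X_j$ with respect to Lebesgue measure. Let $p>1$, $\beta,\gamma>0$ and $\kappa\ge 0$, and let $A=(A_1,\dots,A_m):\mathbb R^m\to\mathbb R^m$ be continuous, locally Lipschitz on $\mathbb R^m\setminus\{0\}$, with $A(0)=0$, such that for a.e. $\xi\in\mathbb R^m$ and every $\eta\in\mathbb R^m$ $$\sum_{i,j=1}^m\frac{\partial A_j}{\partial \xi_i}(\xi)\,\eta_i\eta_j\ \ge\ \beta(\kappa+|\xi|)^{p-2}|\eta|^2,\qquad \sum_{i,j=1}^m\Big|\frac{\partial A_j}{\partial \xi_i}(\xi)\Big|\ \le\ \gamma(\kappa+|\xi|)^{p-2}.$$ Let $f:\Omega\times\mathbb R\to\mathbb R$ be such that for all $x\in\Omega$ the function $f(x,\cdot)$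 is nonincreasing (that is, $\partial_uf\le 0$), and, for some constant $\bar C>0$, $|f(x,s)|\le\bar C(\kappa+|s|)^{p-2}|s|$ for all $x\in\Omega$, $s\in\mathbb R$ (for $s=0$ the right-hand side is understood as $0$). Let $u\in C^1(\Omega)$ (for instance $u\in C^1(\bar\Omega)$) be a weak solution of $\sum_{j=1}^m X_j^*(A_j(Xu))=f(x,u)$ in $\Omega$, that is, $x\mapsto f(x,u(x))$ is locally integrable in $\Omega$ and $$\int_\Omega\sum_{j=1}^m A_j(Xu)\,X_j\varphi\,dx=\int_\Omega f(x,u)\,\varphi\,dx\qquad\text{for all }\varphi\in C^1_c(\Omega).$$ If $u\ge0$ in $\Omega$, then either $u=0$ everywhere in $\Omega$ or $u>0$ everywhere in $\Omega$. -/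

import Mathlib

open MeasureTheory
open scoped ContDiff

/-- The horizontal gradient `Xu = (X₁u, …, X_m u)`, where `X_j u (x) = Du(x)[X_j(x)]`. -/
noncomputable def horizontalGradient {n m : ℕ}
    (X : Fin m → EuclideanSpace ℝ (Fin n) → EuclideanSpace ℝ (Fin n))
    (u : EuclideanSpace ℝ (Fin n) → ℝ) (x : EuclideanSpace ℝ (Fin n)) :
    EuclideanSpace ℝ (Fin m) :=
  WithLp.toLp 2 fun j => fderiv ℝ u x (X j x)

/-- `GeneratedLieAlgebra X V`: the vector field `V` belongs to `Lie[X₁, …, X_m]`, the smallest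
real vector space of vector fields that contains every `X_j` and is closed under Lie brackets. -/
inductive GeneratedLieAlgebra {n m : ℕ}
    (X : Fin m → EuclideanSpace ℝ (Fin n) → EuclideanSpace ℝ (Fin n)) :
    (EuclideanSpace ℝ (Fin n) → EuclideanSpace ℝ (Fin n)) → Prop
  | generator (j : Fin m) : GeneratedLieAlgebra X (X j)
  | zero : GeneratedLieAlgebra X 0
  | add {V W : EuclideanSpace ℝ (Fin n) → EuclideanSpace ℝ (Fin n)} :
      GeneratedLieAlgebra X V → GeneratedLieAlgebra X W → GeneratedLieAlgebra X (V + W)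
  | smul (c : ℝ) {V : EuclideanSpace ℝ (Fin n) → EuclideanSpace ℝ (Fin n)} :
      GeneratedLieAlgebra X V → GeneratedLieAlgebra X (c • V)
  | bracket {V W : EuclideanSpace ℝ (Fin n) → EuclideanSpace ℝ (Fin n)} :
      GeneratedLieAlgebra X V → GeneratedLieAlgebra X W →
        GeneratedLieAlgebra X (VectorField.lieBracket ℝ V W)

/-- Hörmander's finite rank condition `rank Lie[X₁, …, X_m](x) = n` at every point of `Ω`. -/
def HormanderCondition {n m : ℕ} (Ω : Set (EuclideanSpace ℝ (Fin n)))
    (X : Fin m → EuclideanSpace ℝ (Fin n) → EuclideanSpace ℝ (Fin n)) : Prop :=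
  ∀ x ∈ Ω, Module.finrank ℝ
    (Submodule.span ℝ {w : EuclideanSpace ℝ (Fin n) | ∃ V, GeneratedLieAlgebra X V ∧ w = V x}) = n

/-- The partial derivative `∂A_j/∂ξ_i (ξ)`. -/
noncomputable def partialDerivComponent {m : ℕ}
    (A : EuclideanSpace ℝ (Fin m) → EuclideanSpace ℝ (Fin m)) (i j : Fin m)
    (ξ : EuclideanSpace ℝ (Fin m)) : ℝ :=
  fderiv ℝ A ξ (EuclideanSpace.single i 1) j

/-- The structure conditions on `A = (A₁, …, A_m)`: ellipticity and growth of order `p`, for almost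
every `ξ`. The first three fields give the partial derivatives and the equation their meaning: they
hold when `A` is smooth outside the origin and `|A(ξ)| ≤ C (κ + |ξ|) ^ (p - 2) |ξ|`. -/
structure StructureConditions {m : ℕ} (p κ β γ : ℝ)
    (A : EuclideanSpace ℝ (Fin m) → EuclideanSpace ℝ (Fin m)) : Prop where
  continuous : Continuous A
  map_zero : A 0 = 0
  locallyLipschitz : LocallyLipschitzOn {0}ᶜ A
  ellipticity : ∀ᵐ ξ : EuclideanSpace ℝ (Fin m), ∀ η : EuclideanSpace ℝ (Fin m),
    β * (κ + ‖ξ‖) ^ (p - 2) * ‖η‖ ^ 2 ≤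
      ∑ i, ∑ j, partialDerivComponent A i j ξ * η i * η j
  growth : ∀ᵐ ξ : EuclideanSpace ℝ (Fin m),
    ∑ i, ∑ j, |partialDerivComponent A i j ξ| ≤ γ * (κ + ‖ξ‖) ^ (p - 2)

/-- `u` is a weak solution in `Ω` of `∑ j, X_j^* (A_j (Xu)) = f (x, u)`, where `X_j^*` is the adjoint
of `X_j` in `L²` of Lebesgue measure: the equation holds against every test function
`φ ∈ C_c^1(Ω)`. -/
structure IsWeakSolution {n m : ℕ} (Ω : Set (EuclideanSpace ℝ (Fin n)))
    (X : Fin m → EuclideanSpace ℝ (Fin n) → EuclideanSpace ℝ (Fin n))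
    (A : EuclideanSpace ℝ (Fin m) → EuclideanSpace ℝ (Fin m))
    (f : EuclideanSpace ℝ (Fin n) → ℝ → ℝ) (u : EuclideanSpace ℝ (Fin n) → ℝ) : Prop where
  locallyIntegrable_rhs : LocallyIntegrableOn (fun x => f x (u x)) Ω volume
  equation : ∀ φ : EuclideanSpace ℝ (Fin n) → ℝ,
    ContDiff ℝ 1 φ → HasCompactSupport φ → tsupport φ ⊆ Ω →
      ∫ x in Ω, ∑ j, A (horizontalGradient X u x) j * horizontalGradient X φ x j =
        ∫ x in Ω, f x (u x) * φ x

/-! Let `F` be the zero set of `u` in `Ω`, assumed nonempty. It is relatively closed, so by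
connectedness it suffices that `F` is open. This is proved through proximal normals: `ν` is one at
`y` when, up to rescaling, `F` lies near `y` outside a ball centred at a point `y + t • ν` and
touching `F` at `y`.

Hopf's lemma (`IsWeakSolution.isTangentField_zeros`): if some `X j y` is not orthogonal to `ν`, the
squared distance to the centre of a touching ball has nonzero horizontal gradient near `y`. The
barrier `ε (exp (-α |x - x₀|²) - exp (-α r²))` is then a strict weak subsolution in a small ball
about `y`, so comparison puts it below `u`, with equality at `y`. Both `u` and `u - w` have a
minimum at `y`, so the gradient of the barrier `w` vanishes there, a contradiction. Hence every `X
j` is orthogonal to all proximal normals of `F`.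

Orthogonality passes to brackets (`IsTangentField.lieBracket`): a nearly closed control curve built
from two tangent fields stays close to `F`, while its endpoint moves in the direction of the
bracket. By Hörmander's condition all proximal normals vanish. A displacement from a nearest point
is a proximal normal, so every point near `F` is its own nearest point: `F` is open.

The analytic difficulty is that `A` is differentiable only almost everywhere and may degenerate at
the origin. Fubini's theorem turns the a.e. structure conditions into bounds on increments
(`LocallyLipschitzOn.le_inner_sub_of_ae`); mollification then gives smooth fields with the same
bounds away from `0`, for which the barrier inequality is a pointwise computation of a divergence.
Integration by parts and a limit yield the weak inequality. -/

open Set Filter Topology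

/-! ### Proximal normals and approximate invariance of a set. -/

section ProximalNormals

variable {E : Type*} [NormedAddCommGroup E] [InnerProductSpace ℝ E]

/-- `ν` is a proximal normal to the set `F` at `y`. -/
def IsProximalNormal (F : Set E) (y ν : E) : Prop :=
  ∃ σ : ℝ, ∀ᶠ z in 𝓝[F] y, inner ℝ ν (z - y) ≤ σ * ‖z - y‖ ^ 2

/-- The vector field `V` is orthogonal to every proximal normal of `F`. -/
def IsTangentField (F : Set E) (V : E → E) : Prop :=
  ∀ y ∈ F, ∀ ν, IsProximalNormal F y ν → inner ℝ (V y) ν = 0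

/-- A displacement to a nearest point is a proximal normal. -/
lemma isProximalNormal_of_nearest {F : Set E} {c π : E}
    (h : ∀ᶠ z in 𝓝[F] π, ‖c - π‖ ≤ ‖c - z‖) : IsProximalNormal F π (c - π) := by
  refine ⟨1 / 2, h.mono fun z hz => ?_⟩
  have h1 : ‖c - z‖ ^ 2 = ‖c - π‖ ^ 2 - 2 * inner ℝ (c - π) (z - π) + ‖z - π‖ ^ 2 := by
    rw [← norm_sub_sq_real]; congr 2; abel
  have h2 : ‖c - π‖ ^ 2 ≤ ‖c - z‖ ^ 2 := by gcongr
  linarith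

/-- A curve whose velocity is almost orthogonal to the displacement from the nearest points of
a compact set stays close to this set. -/
lemma exists_near_of_inner_deriv_le {K : Set E} (hK : IsCompact K) {c c' : ℝ → E} {L ε : ℝ}
    (hL : 0 ≤ L) (hc : ∀ s, HasDerivAt c (c' s) s) (h0 : c 0 ∈ K)
    (h : ∀ s ∈ Ico (0 : ℝ) 1, ∀ π ∈ K, (∀ z ∈ K, ‖c s - π‖ ≤ ‖c s - z‖) →
      inner ℝ (c' s) (c s - π) ≤ ε * ‖c s - π‖ + L * ‖c s - π‖ ^ 2) :
    ∃ π ∈ K, ‖c 1 - π‖ ^ 2 ≤ ε ^ 2 * Real.exp (2 * L + 1) := by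
  have hne : K.Nonempty := ⟨_, h0⟩
  have hcc : Continuous c := continuous_iff_continuousAt.2 fun s => (hc s).continuousAt
  have near : ∀ x : E, ∃ π ∈ K, (∀ z ∈ K, ‖x - π‖ ≤ ‖x - z‖) ∧ Metric.infDist x K = ‖x - π‖ := by
    intro x
    obtain ⟨π, hπ, hd⟩ := hK.exists_infDist_eq_dist hne x
    refine ⟨π, hπ, fun z hz => ?_, by rw [hd, dist_eq_norm]⟩
    rw [← dist_eq_norm, ← hd, ← dist_eq_norm]
    exact Metric.infDist_le_dist_of_mem hz
  set g : ℝ → ℝ := fun s => Metric.infDist (c s) K ^ 2 with hg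
  choose P hPK hPmin hPd using near
  have key := le_gronwallBound_of_liminf_deriv_right_le (f := g)
    (f' := fun s => 2 * inner ℝ (c s - P (c s)) (c' s)) (δ := 0) (K := 2 * L + 1) (ε := ε ^ 2)
    (a := 0) (b := 1) ?_ ?_ ?_ ?_ 1 (by simp)
  · refine ⟨P (c 1), hPK _, ?_⟩
    have h1 : g 1 = ‖c 1 - P (c 1)‖ ^ 2 := by simp only [hg, hPd]
    rw [← h1]
    refine key.trans ?_
    rw [gronwallBound_of_K_ne_0 (by positivity)]
    have hpos : 0 < Real.exp (2 * L + 1) := Real.exp_pos _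
    have : ε ^ 2 / (2 * L + 1) ≤ ε ^ 2 := div_le_self (sq_nonneg _) (by linarith)
    have h2 : 0 ≤ ε ^ 2 / (2 * L + 1) := by positivity
    simp only [sub_zero, mul_one, zero_mul, zero_add]
    nlinarith
  · exact ((Metric.continuous_infDist_pt K).comp hcc).pow 2 |>.continuousOn
  · intro s hs r hr
    -- Freezing the nearest point `P (c s)` bounds `g` from above by a differentiable function with
    -- equality at `s`; its derivative therefore bounds the right difference quotients of `g`.
    apply Eventually.frequently
    have hd : HasDerivAt (fun z => ‖c z - P (c s)‖ ^ 2) (2 * inner ℝ (c s - P (c s)) (c' s)) s :=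
      ((hc s).sub_const _).norm_sq
    have hslope := (hasDerivAt_iff_tendsto_slope.1 hd).mono_left
      (nhdsWithin_mono s (fun z (hz : s < z) => (ne_of_gt hz : z ≠ s)))
    filter_upwards [hslope.eventually (gt_mem_nhds hr), self_mem_nhdsWithin] with z hz hzs
    refine lt_of_le_of_lt ?_ hz
    rw [slope_def_module, smul_eq_mul]
    have hzs' : 0 ≤ (z - s)⁻¹ := inv_nonneg.2 (sub_nonneg.2 (le_of_lt hzs))
    refine mul_le_mul_of_nonneg_left ?_ hzs'
    have h1 : g s = ‖c s - P (c s)‖ ^ 2 := by simp only [hg, hPd]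
    have h2 : g z ≤ ‖c z - P (c s)‖ ^ 2 := by
      simp only [hg]
      rw [← dist_eq_norm]
      gcongr
      · exact Metric.infDist_nonneg
      · exact Metric.infDist_le_dist_of_mem (hPK _)
    linarith
  · simp [hg, Metric.infDist_zero_of_mem h0]
  · intro s hs
    have h1 := h s hs _ (hPK (c s)) (hPmin _)
    rw [real_inner_comm] at h1
    simp only [hg, hPd]
    -- With `d` the distance, `2 * ε * d ≤ ε ^ 2 + d ^ 2`; this is the source of the Grönwall
    -- constants `2 * L + 1` and `ε ^ 2`.
    nlinarith [sq_nonneg (ε - ‖c s - P (c s)‖)]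

end ProximalNormals

/-! ### Control curves whose displacement is a Lie bracket. -/

section Brackets

variable {E : Type*} [NormedAddCommGroup E] [NormedSpace ℝ E]

/-- A second order approximation of a closed control curve for the pair `X`, `Y`; its endpoint
displacement is proportional to the Lie bracket. -/
noncomputable def bracketCurve (X Y : E → E) (y : E) (τ s : ℝ) : E :=
  y + τ • ((s - s ^ 2) • X y + (s ^ 2 - s ^ 3) • Y y) +
    τ ^ 2 • (((s - s ^ 2) ^ 2 / 2) • fderiv ℝ X y (X y) +
      ((s ^ 2 - s ^ 3) ^ 2 / 2) • fderiv ℝ Y y (Y y) +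
      (2 * s ^ 3 / 3 - 5 * s ^ 4 / 4 + 3 * s ^ 5 / 5) • fderiv ℝ Y y (X y) +
      ((s - s ^ 2) * (s ^ 2 - s ^ 3) - (2 * s ^ 3 / 3 - 5 * s ^ 4 / 4 + 3 * s ^ 5 / 5)) •
        fderiv ℝ X y (Y y))

/-- The velocity of `bracketCurve`. -/
noncomputable def bracketCurveDeriv (X Y : E → E) (y : E) (τ s : ℝ) : E :=
  τ • ((1 - 2 * s) • X y + (2 * s - 3 * s ^ 2) • Y y) +
    τ ^ 2 • (((s - s ^ 2) * (1 - 2 * s)) • fderiv ℝ X y (X y) +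
      ((s ^ 2 - s ^ 3) * (2 * s - 3 * s ^ 2)) • fderiv ℝ Y y (Y y) +
      ((s - s ^ 2) * (2 * s - 3 * s ^ 2)) • fderiv ℝ Y y (X y) +
      ((1 - 2 * s) * (s ^ 2 - s ^ 3)) • fderiv ℝ X y (Y y))

lemma bracketCurve_zero (X Y : E → E) (y : E) (τ : ℝ) : bracketCurve X Y y τ 0 = y := by
  simp [bracketCurve]

/-- The controls `1 - 2 * s` and `2 * s - 3 * s ^ 2` have primitives `s - s ^ 2` and `s ^ 2 - s ^
3`, which vanish at both ends. Only the mixed iterated integrals survive, and they equal `2/3 - 5/4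
+ 3/5 = 1/60` and `-1/60`. -/
lemma bracketCurve_one (X Y : E → E) (y : E) (τ : ℝ) :
    bracketCurve X Y y τ 1 = y + (τ ^ 2 / 60) • VectorField.lieBracket ℝ X Y y := by
  simp only [bracketCurve, VectorField.lieBracket]
  module

lemma hasDerivAt_bracketCurve (X Y : E → E) (y : E) (τ s : ℝ) :
    HasDerivAt (bracketCurve X Y y τ) (bracketCurveDeriv X Y y τ s) s := by
  have h1 : HasDerivAt (fun s : ℝ => s - s ^ 2) (1 - 2 * s) s := 
    ((hasDerivAt_id' s).sub (hasDerivAt_pow 2 s)).congr_deriv (by norm_num)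
  have h2 : HasDerivAt (fun s : ℝ => s ^ 2 - s ^ 3) (2 * s - 3 * s ^ 2) s := 
    ((hasDerivAt_pow 2 s).sub (hasDerivAt_pow 3 s)).congr_deriv (by norm_num)
  have h3 : HasDerivAt (fun s : ℝ => (s - s ^ 2) ^ 2 / 2) ((s - s ^ 2) * (1 - 2 * s)) s := by
    refine ((h1.pow 2).div_const 2).congr_deriv ?_
    push_cast; ring
  have h4 : HasDerivAt (fun s : ℝ => (s ^ 2 - s ^ 3) ^ 2 / 2)
      ((s ^ 2 - s ^ 3) * (2 * s - 3 * s ^ 2)) s := by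
    refine ((h2.pow 2).div_const 2).congr_deriv ?_
    push_cast; ring
  have h5 : HasDerivAt (fun s : ℝ => 2 * s ^ 3 / 3 - 5 * s ^ 4 / 4 + 3 * s ^ 5 / 5)
      ((s - s ^ 2) * (2 * s - 3 * s ^ 2)) s := by
    refine (((((hasDerivAt_pow 3 s).const_mul 2).div_const 3).sub
      (((hasDerivAt_pow 4 s).const_mul 5).div_const 4)).add
      (((hasDerivAt_pow 5 s).const_mul 3).div_const 5)).congr_deriv ?_
    push_cast; ring
  have h6 : HasDerivAt (fun s : ℝ => (s - s ^ 2) * (s ^ 2 - s ^ 3) -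
      (2 * s ^ 3 / 3 - 5 * s ^ 4 / 4 + 3 * s ^ 5 / 5)) ((1 - 2 * s) * (s ^ 2 - s ^ 3)) s := by
    refine ((h1.mul h2).sub h5).congr_deriv ?_
    ring
  exact ((((h1.smul_const (X y)).add (h2.smul_const (Y y))).const_smul τ).const_add y).add
    (((((h3.smul_const _).add (h4.smul_const _)).add (h5.smul_const _)).add
      (h6.smul_const _)).const_smul (τ ^ 2))

lemma norm_bracketCurve_sub_le (X Y : E → E) (y : E) :
    ∃ C : ℝ, 0 < C ∧ ∀ τ ∈ Icc (0 : ℝ) 1, ∀ s ∈ Icc (0 : ℝ) 1,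
      ‖bracketCurve X Y y τ s - y‖ ≤ C * τ := by
  have hcont : Continuous fun q : ℝ × ℝ =>
      ((q.2 - q.2 ^ 2) • X y + (q.2 ^ 2 - q.2 ^ 3) • Y y) +
    q.1 • (((q.2 - q.2 ^ 2) ^ 2 / 2) • fderiv ℝ X y (X y) +
      ((q.2 ^ 2 - q.2 ^ 3) ^ 2 / 2) • fderiv ℝ Y y (Y y) +
      (2 * q.2 ^ 3 / 3 - 5 * q.2 ^ 4 / 4 + 3 * q.2 ^ 5 / 5) • fderiv ℝ Y y (X y) +
      ((q.2 - q.2 ^ 2) * (q.2 ^ 2 - q.2 ^ 3) -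
        (2 * q.2 ^ 3 / 3 - 5 * q.2 ^ 4 / 4 + 3 * q.2 ^ 5 / 5)) • fderiv ℝ X y (Y y)) := by
    fun_prop
  obtain ⟨C, hC⟩ := ((isCompact_Icc (a := (0 : ℝ)) (b := 1)).prod
    (isCompact_Icc (a := (0 : ℝ)) (b := 1))).exists_bound_of_continuousOn hcont.continuousOn
  refine ⟨|C| + 1, by positivity, fun τ hτ s hs => ?_⟩
  have h := hC (τ, s) ⟨hτ, hs⟩
  have : bracketCurve X Y y τ s - y = τ • (((s - s ^ 2) • X y + (s ^ 2 - s ^ 3) • Y y) +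
    τ • (((s - s ^ 2) ^ 2 / 2) • fderiv ℝ X y (X y) +
      ((s ^ 2 - s ^ 3) ^ 2 / 2) • fderiv ℝ Y y (Y y) +
      (2 * s ^ 3 / 3 - 5 * s ^ 4 / 4 + 3 * s ^ 5 / 5) • fderiv ℝ Y y (X y) +
      ((s - s ^ 2) * (s ^ 2 - s ^ 3) -
        (2 * s ^ 3 / 3 - 5 * s ^ 4 / 4 + 3 * s ^ 5 / 5)) • fderiv ℝ X y (Y y))) := by
    rw [bracketCurve]; module
  rw [this, norm_smul, Real.norm_of_nonneg hτ.1, mul_comm]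
  gcongr
  · exact hτ.1
  · exact h.trans ((le_abs_self C).trans (by linarith))

/-- The curve `bracketCurve` solves a control equation for `X`, `Y` up to an error `o(τ ^ 2)`. -/
lemma norm_bracketCurveDeriv_sub_le {X Y : E → E} {y : E} (hX : DifferentiableAt ℝ X y)
    (hY : DifferentiableAt ℝ Y y) {η : ℝ} (hη : 0 < η) :
    ∀ᶠ τ in 𝓝[>] (0 : ℝ), ∀ s ∈ Icc (0 : ℝ) 1,
      ‖bracketCurveDeriv X Y y τ s - ((τ * (1 - 2 * s)) • X (bracketCurve X Y y τ s) +
        (τ * (2 * s - 3 * s ^ 2)) • Y (bracketCurve X Y y τ s))‖ ≤ η * τ ^ 2 := by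
  obtain ⟨C, hC0, hC⟩ := norm_bracketCurve_sub_le X Y y
  have hcont : Continuous fun s : ℝ => (((s - s ^ 2) ^ 2 / 2) • fderiv ℝ X y (X y) +
      ((s ^ 2 - s ^ 3) ^ 2 / 2) • fderiv ℝ Y y (Y y) +
      (2 * s ^ 3 / 3 - 5 * s ^ 4 / 4 + 3 * s ^ 5 / 5) • fderiv ℝ Y y (X y) +
      ((s - s ^ 2) * (s ^ 2 - s ^ 3) - (2 * s ^ 3 / 3 - 5 * s ^ 4 / 4 + 3 * s ^ 5 / 5)) •
        fderiv ℝ X y (Y y)) := by fun_prop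
  set r : ℝ → E := fun s => (((s - s ^ 2) ^ 2 / 2) • fderiv ℝ X y (X y) +
      ((s ^ 2 - s ^ 3) ^ 2 / 2) • fderiv ℝ Y y (Y y) +
      (2 * s ^ 3 / 3 - 5 * s ^ 4 / 4 + 3 * s ^ 5 / 5) • fderiv ℝ Y y (X y) +
      ((s - s ^ 2) * (s ^ 2 - s ^ 3) - (2 * s ^ 3 / 3 - 5 * s ^ 4 / 4 + 3 * s ^ 5 / 5)) •
        fderiv ℝ X y (Y y)) with hr
  have hcont2 : Continuous fun s : ℝ =>
    (1 - 2 * s) • fderiv ℝ X y (r s) + (2 * s - 3 * s ^ 2) • fderiv ℝ Y y (r s) := by fun_prop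
  obtain ⟨M, hM⟩ :=
    (isCompact_Icc (a := (0 : ℝ)) (b := 1)).exists_bound_of_continuousOn hcont2.continuousOn
  -- Each of the two linearization errors then costs at most `η / 4 * τ ^ 2`; the cubic term gets
  -- the remaining half of `η`.
  set δ := η / (4 * C) with hδ
  have hδ0 : 0 < δ := by positivity
  have eX := hX.hasFDerivAt.isLittleO.bound hδ0
  have eY := hY.hasFDerivAt.isLittleO.bound hδ0
  obtain ⟨ρ, hρ, hball⟩ := Metric.eventually_nhds_iff.1 (eX.and eY)
  have t1 : Tendsto (fun τ : ℝ => C * τ) (𝓝[>] 0) (𝓝 0) := by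
    have : Tendsto (fun τ : ℝ => C * τ) (𝓝 0) (𝓝 (C * 0)) := (continuous_const_mul C).tendsto 0
    rw [mul_zero] at this
    exact this.mono_left nhdsWithin_le_nhds
  have t2 : Tendsto (fun τ : ℝ => M * τ) (𝓝[>] 0) (𝓝 0) := by
    have : Tendsto (fun τ : ℝ => M * τ) (𝓝 0) (𝓝 (M * 0)) := (continuous_const_mul M).tendsto 0
    rw [mul_zero] at this
    exact this.mono_left nhdsWithin_le_nhds
  filter_upwards [t1.eventually (gt_mem_nhds hρ), t2.eventually (gt_mem_nhds (half_pos hη)),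
    self_mem_nhdsWithin, mem_nhdsWithin_of_mem_nhds (Iic_mem_nhds (zero_lt_one' ℝ))]
    with τ hτρ hτM hτ0 hτ1 s hs
  have hτ0' : 0 < τ := hτ0
  have hcy := hC τ ⟨hτ0'.le, hτ1⟩ s hs
  set c := bracketCurve X Y y τ s with hc
  obtain ⟨bX, bY⟩ := hball (show dist c y < ρ by rw [dist_eq_norm]; linarith)
  set errX := X c - X y - fderiv ℝ X y (c - y) with herrX
  set errY := Y c - Y y - fderiv ℝ Y y (c - y) with herrY
  have hXc : X c = X y + fderiv ℝ X y (c - y) + errX := by rw [herrX]; abel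
  have hYc : Y c = Y y + fderiv ℝ Y y (c - y) + errY := by rw [herrY]; abel
  have hcy' : c - y = τ • ((s - s ^ 2) • X y + (s ^ 2 - s ^ 3) • Y y) + τ ^ 2 • r s := by
    rw [hc, bracketCurve, hr]; module
  -- The coefficients of the curve are chosen so that all terms of order `τ` and `τ ^ 2` cancel.
  have expand : bracketCurveDeriv X Y y τ s - ((τ * (1 - 2 * s)) • X c +
        (τ * (2 * s - 3 * s ^ 2)) • Y c) =
      -(τ ^ 3 • ((1 - 2 * s) • fderiv ℝ X y (r s) + (2 * s - 3 * s ^ 2) • fderiv ℝ Y y (r s)))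
      - (τ * (1 - 2 * s)) • errX - (τ * (2 * s - 3 * s ^ 2)) • errY := by
    rw [hXc, hYc, hcy', bracketCurveDeriv]
    simp only [map_add, map_smul]
    module
  rw [expand]
  have a1 : |1 - 2 * s| ≤ 1 := abs_le.2 ⟨by linarith [hs.2], by linarith [hs.1]⟩
  have a2 : |2 * s - 3 * s ^ 2| ≤ 1 :=
    abs_le.2 ⟨by nlinarith [hs.1, hs.2], by nlinarith [sq_nonneg (3 * s - 1)]⟩
  have n1 : ‖τ ^ 3 • ((1 - 2 * s) • fderiv ℝ X y (r s) +
      (2 * s - 3 * s ^ 2) • fderiv ℝ Y y (r s))‖ ≤ τ ^ 3 * M := by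
    rw [norm_smul, Real.norm_of_nonneg (by positivity)]
    exact mul_le_mul_of_nonneg_left (hM s hs) (by positivity)
  have n2 : ‖(τ * (1 - 2 * s)) • errX‖ ≤ τ * (δ * (C * τ)) := by
    rw [norm_smul, norm_mul, Real.norm_of_nonneg hτ0'.le, Real.norm_eq_abs, mul_assoc]
    refine mul_le_mul_of_nonneg_left ?_ hτ0'.le
    calc |1 - 2 * s| * ‖errX‖ ≤ 1 * ‖errX‖ := by gcongr
      _ ≤ δ * ‖c - y‖ := by rw [one_mul]; exact bX
      _ ≤ δ * (C * τ) := by gcongr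
  have n3 : ‖(τ * (2 * s - 3 * s ^ 2)) • errY‖ ≤ τ * (δ * (C * τ)) := by
    rw [norm_smul, norm_mul, Real.norm_of_nonneg hτ0'.le, Real.norm_eq_abs, mul_assoc]
    refine mul_le_mul_of_nonneg_left ?_ hτ0'.le
    calc |2 * s - 3 * s ^ 2| * ‖errY‖ ≤ 1 * ‖errY‖ := by gcongr
      _ ≤ δ * ‖c - y‖ := by rw [one_mul]; exact bY
      _ ≤ δ * (C * τ) := by gcongr
  have e : τ * (δ * (C * τ)) = η / 4 * τ ^ 2 := by rw [hδ]; field_simp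
  refine (norm_sub_le_of_le (norm_sub_le_of_le ((norm_neg _).trans_le n1) n2) n3).trans ?_
  rw [e]
  nlinarith [mul_le_mul_of_nonneg_left hτM.le (sq_nonneg τ)]

end Brackets

/-! ### Tangency is inherited by Lie brackets. -/

section TangentFields

variable {E : Type*} [NormedAddCommGroup E] [InnerProductSpace ℝ E]

/-- Supplies the hypothesis of `exists_near_of_inner_deriv_le`: at the nearest point the fields are
orthogonal to `d`, so only their variation, of size `‖d‖`, contributes. -/
lemma inner_le_of_near_combination {v x₁ y₁ x₀ y₀ d : E} {a b ε lx ly : ℝ} (ha : |a| ≤ 1)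
    (hb : |b| ≤ 1) (hv : ‖v - (a • x₁ + b • y₁)‖ ≤ ε) (hx : ‖x₁ - x₀‖ ≤ lx * ‖d‖)
    (hy : ‖y₁ - y₀‖ ≤ ly * ‖d‖) (ix : inner ℝ x₀ d = 0) (iy : inner ℝ y₀ d = 0) :
    inner ℝ v d ≤ ε * ‖d‖ + (lx + ly) * ‖d‖ ^ 2 := by
  have split : v = (v - (a • x₁ + b • y₁)) + (a • (x₁ - x₀) + b • (y₁ - y₀)) +
      (a • x₀ + b • y₀) := by module
  have z3 : inner ℝ (a • x₀ + b • y₀) d = 0 := by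
    rw [inner_add_left, inner_smul_left, inner_smul_left, ix, iy]; simp
  have z1 := (real_inner_le_norm (v - (a • x₁ + b • y₁)) d).trans
    (mul_le_mul_of_nonneg_right hv (norm_nonneg _))
  have b1 : ‖a • (x₁ - x₀)‖ ≤ lx * ‖d‖ := by
    rw [norm_smul, Real.norm_eq_abs]
    exact (mul_le_of_le_one_left (norm_nonneg _) ha).trans hx
  have b2 : ‖b • (y₁ - y₀)‖ ≤ ly * ‖d‖ := by
    rw [norm_smul, Real.norm_eq_abs]
    exact (mul_le_of_le_one_left (norm_nonneg _) hb).trans hy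
  have z2 := (real_inner_le_norm (a • (x₁ - x₀) + b • (y₁ - y₀)) d).trans
    (mul_le_mul_of_nonneg_right (norm_add_le_of_le b1 b2) (norm_nonneg _))
  rw [split, inner_add_left, inner_add_left, z3]
  linarith

set_option maxHeartbeats 800000 in
-- The bracket curve ends at `y + (τ ^ 2 / 60) • [X, Y]` and lies within `o(τ ^ 2)` of a point `π`
-- of `F`. The proximal inequality at `π` gives `⟨ν, π - y⟩ = O(τ ^ 4)` as an upper bound; dividing
-- by `τ ^ 2` leaves a nonpositive limit.
lemma IsTangentField.inner_lieBracket_nonpos {F : Set E}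
    (hF : ∀ y ∈ F, ∃ R > 0, ∀ r ≤ R, IsCompact (F ∩ Metric.closedBall y r)) {X Y : E → E}
    (hX : ContDiff ℝ 1 X) (hY : ContDiff ℝ 1 Y) (tX : IsTangentField F X)
    (tY : IsTangentField F Y) {y ν : E} (hy : y ∈ F) (hν : IsProximalNormal F y ν) :
    inner ℝ (VectorField.lieBracket ℝ X Y y) ν ≤ 0 := by
  obtain ⟨R₀, hR₀, hcompact⟩ := hF y hy
  obtain ⟨LX, sX, hsX, hLX⟩ := hX.contDiffAt.exists_lipschitzOnWith (x := y)
  obtain ⟨LY, sY, hsY, hLY⟩ := hY.contDiffAt.exists_lipschitzOnWith (x := y)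
  obtain ⟨σ, hσ⟩ := hν
  rw [eventually_nhdsWithin_iff] at hσ
  obtain ⟨R₁, hR₁, hball⟩ := Metric.eventually_nhds_iff.1
    ((eventually_mem_set.2 hsX).and ((eventually_mem_set.2 hsY).and hσ))
  set R := min R₀ (R₁ / 2) with hR
  have hRpos : 0 < R := lt_min hR₀ (by positivity)
  have hRR : R < R₁ := (min_le_right _ _).trans_lt (by linarith)
  set K := F ∩ Metric.closedBall y R with hK
  have hKc : IsCompact K := hcompact R (min_le_left _ _)
  have hyK : y ∈ K := ⟨hy, by simp [hRpos.le]⟩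
  obtain ⟨C, hC0, hC⟩ := norm_bracketCurve_sub_le X Y y
  set L : ℝ := LX + LY with hL
  have hL0 : 0 ≤ L := by positivity
  set D := VectorField.lieBracket ℝ X Y y with hD
  set A₁ := √(Real.exp (2 * L + 1)) with hA₁
  set A₂ := A₁ + ‖D‖ / 60 with hA₂
  have hA₁0 : 0 ≤ A₁ := Real.sqrt_nonneg _
  have hA₂0 : 0 ≤ A₂ := by positivity
  have main : ∀ η : ℝ, 0 < η → η ≤ 1 →
      inner ℝ D ν / 60 ≤ η * (‖ν‖ * A₁ + |σ| * A₂ ^ 2) := by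
    intro η hη hη1
    have t1 : Tendsto (fun τ : ℝ => C * τ) (𝓝[>] 0) (𝓝 0) := by
      have : Tendsto (fun τ : ℝ => C * τ) (𝓝 0) (𝓝 (C * 0)) := (continuous_const_mul C).tendsto 0
      rw [mul_zero] at this
      exact this.mono_left nhdsWithin_le_nhds
    obtain ⟨τ, ⟨⟨hτerr, hτR⟩, hτη⟩, hτ0⟩ := ((((norm_bracketCurveDeriv_sub_le
      (hX.differentiable one_ne_zero y) (hY.differentiable one_ne_zero y) hη).and
      (t1.eventually (gt_mem_nhds (show 0 < R / 4 by positivity)))).and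
      (mem_nhdsWithin_of_mem_nhds (Iic_mem_nhds hη))).and self_mem_nhdsWithin).exists
    have hτ0 : 0 < τ := hτ0
    have hτη : τ ≤ η := hτη
    have hτ1 : τ ≤ 1 := hτη.trans hη1
    set c := bracketCurve X Y y τ with hc
    have hcR : ∀ s ∈ Icc (0 : ℝ) 1, ‖c s - y‖ < R / 4 := fun s hs =>
      (hC τ ⟨hτ0.le, hτ1⟩ s hs).trans_lt hτR
    obtain ⟨π, hπK, hπ⟩ := exists_near_of_inner_deriv_le hKc (c := c)
      (c' := bracketCurveDeriv X Y y τ) (L := L) (ε := η * τ ^ 2) hL0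
      (hasDerivAt_bracketCurve X Y y τ) (by rw [hc, bracketCurve_zero]; exact hyK) (by
        intro s hs π hπ hmin
        have hs' : s ∈ Icc (0 : ℝ) 1 := ⟨hs.1, hs.2.le⟩
        have h1 : ‖c s - π‖ < R / 4 := (hmin y hyK).trans_lt (hcR s hs')
        have h2 : ‖π - y‖ < R / 2 := by
          calc ‖π - y‖ = ‖(c s - y) - (c s - π)‖ := by congr 1; abel
            _ ≤ ‖c s - y‖ + ‖c s - π‖ := norm_sub_le _ _
            _ < R / 2 := by linarith [hcR s hs']
        -- `π` is within `R / 2` of `y`, so near `π` the truncated set `K` coincides with `F` and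
        -- `π` is a locally nearest point of `F` itself.
        have hnormal : IsProximalNormal F π (c s - π) := by
          apply isProximalNormal_of_nearest
          rw [eventually_nhdsWithin_iff]
          filter_upwards [Metric.ball_mem_nhds π (half_pos hRpos)] with z hz hzF
          refine hmin z ⟨hzF, ?_⟩
          rw [Metric.mem_ball, dist_eq_norm] at hz
          rw [Metric.mem_closedBall, dist_eq_norm]
          calc ‖z - y‖ = ‖(z - π) + (π - y)‖ := by congr 1; abel
            _ ≤ ‖z - π‖ + ‖π - y‖ := norm_add_le _ _
            _ ≤ R := by linarith
        have iX := tX π hπ.1 _ hnormal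
        have iY := tY π hπ.1 _ hnormal
        have hcs : dist (c s) y < R₁ := by rw [dist_eq_norm]; linarith [hcR s hs']
        have hπs : dist π y < R₁ := by rw [dist_eq_norm]; linarith
        have lX : ‖X (c s) - X π‖ ≤ LX * ‖c s - π‖ := by
          simpa [dist_eq_norm] using hLX.dist_le_mul _ (hball hcs).1 _ (hball hπs).1
        have lY : ‖Y (c s) - Y π‖ ≤ LY * ‖c s - π‖ := by
          simpa [dist_eq_norm] using hLY.dist_le_mul _ (hball hcs).2.1 _ (hball hπs).2.1
        have a1 : |1 - 2 * s| ≤ 1 := abs_le.2 ⟨by linarith [hs'.2], by linarith [hs'.1]⟩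
        have a2 : |2 * s - 3 * s ^ 2| ≤ 1 :=
          abs_le.2 ⟨by nlinarith [hs'.1, hs'.2], by nlinarith [sq_nonneg (3 * s - 1)]⟩
        refine inner_le_of_near_combination ?_ ?_ (hτerr s hs') lX lY iX iY
        · rw [abs_mul, abs_of_pos hτ0]
          exact mul_le_one₀ hτ1 (abs_nonneg _) a1
        · rw [abs_mul, abs_of_pos hτ0]
          exact mul_le_one₀ hτ1 (abs_nonneg _) a2)
    have hc1 : c 1 - y = (τ ^ 2 / 60) • D := by rw [hc, bracketCurve_one]; abel
    have d1 : ‖c 1 - π‖ ≤ η * τ ^ 2 * A₁ := by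
      refine (sq_le_sq₀ (norm_nonneg _) (by positivity)).1 ?_
      rw [mul_pow, hA₁, Real.sq_sqrt (Real.exp_pos _).le]
      exact hπ
    have d2 : ‖π - y‖ ≤ τ ^ 2 * A₂ := by
      calc ‖π - y‖ = ‖(c 1 - y) - (c 1 - π)‖ := by congr 1; abel
        _ ≤ ‖c 1 - y‖ + ‖c 1 - π‖ := norm_sub_le _ _
        _ ≤ τ ^ 2 / 60 * ‖D‖ + 1 * τ ^ 2 * A₁ := by
          rw [hc1, norm_smul, Real.norm_of_nonneg (by positivity)]
          gcongr
          exact d1.trans (by gcongr)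
        _ = τ ^ 2 * A₂ := by rw [hA₂]; ring
    have hπy : dist π y < R₁ := (Metric.mem_closedBall.1 hπK.2).trans_lt hRR
    have hin := (hball hπy).2.2 hπK.1
    have e1 : τ ^ 2 / 60 * inner ℝ D ν = inner ℝ ν (c 1 - π) + inner ℝ ν (π - y) := by
      rw [← inner_add_right, sub_add_sub_cancel, hc1, inner_smul_right, real_inner_comm]
    have e2 : inner ℝ ν (c 1 - π) ≤ ‖ν‖ * (η * τ ^ 2 * A₁) :=
      (real_inner_le_norm _ _).trans (by gcongr)
    have e3 : σ * ‖π - y‖ ^ 2 ≤ |σ| * (τ ^ 2 * A₂) ^ 2 :=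
      mul_le_mul (le_abs_self σ) (by gcongr) (by positivity) (abs_nonneg _)
    have e4 : τ ^ 2 ≤ η := by nlinarith
    have e5 : |σ| * (τ ^ 2 * A₂) ^ 2 ≤ |σ| * (τ ^ 2 * η * A₂ ^ 2) := by
      rw [mul_pow, sq (τ ^ 2)]
      gcongr
    have hτ2 : 0 < τ ^ 2 := by positivity
    have : τ ^ 2 * (inner ℝ D ν / 60) ≤ τ ^ 2 * (η * (‖ν‖ * A₁ + |σ| * A₂ ^ 2)) := by
      linarith
    exact le_of_mul_le_mul_left this hτ2
  by_contra hpos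
  push Not at hpos
  set B := ‖ν‖ * A₁ + |σ| * A₂ ^ 2 with hB
  have hB0 : 0 ≤ B := by positivity
  set i := inner ℝ D ν with hi
  -- With this `η` the bound `main` reads `i / 60 ≤ i / 61`, absurd for `i > 0`.
  have hη0 : 0 < min 1 (i / (61 * (B + 1))) := lt_min one_pos (by positivity)
  have h1 := main _ hη0 (min_le_left _ _)
  have h2 : min 1 (i / (61 * (B + 1))) * B ≤ i / (61 * (B + 1)) * B := by
    gcongr; exact min_le_right _ _
  have h3 : i / (61 * (B + 1)) * B ≤ i / 61 := by
    rw [div_mul_eq_mul_div, div_le_div_iff₀ (by positivity) (by norm_num)]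
    nlinarith
  linarith

/-- Exchanging `X` and `Y` changes the sign of the bracket, so the one-sided bound becomes an
equality. -/
lemma IsTangentField.lieBracket {F : Set E}
    (hF : ∀ y ∈ F, ∃ R > 0, ∀ r ≤ R, IsCompact (F ∩ Metric.closedBall y r)) {X Y : E → E}
    (hX : ContDiff ℝ 1 X) (hY : ContDiff ℝ 1 Y) (tX : IsTangentField F X)
    (tY : IsTangentField F Y) : IsTangentField F (VectorField.lieBracket ℝ X Y) := by
  intro y hy ν hν
  refine le_antisymm (IsTangentField.inner_lieBracket_nonpos hF hX hY tX tY hy hν) ?_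
  have h := IsTangentField.inner_lieBracket_nonpos hF hY hX tY tX hy hν
  rw [VectorField.lieBracket_swap] at h
  simp only [inner_neg_left] at h
  linarith

end TangentFields

/-! ### From tangent generators to openness of the set. -/

/-- Fields of the Lie algebra generated by smooth tangent fields are smooth and tangent. -/
lemma GeneratedLieAlgebra.contDiff_and_isTangentField {n m : ℕ}
    {X : Fin m → EuclideanSpace ℝ (Fin n) → EuclideanSpace ℝ (Fin n)}
    (hX : ∀ j, ContDiff ℝ ∞ (X j)) {F : Set (EuclideanSpace ℝ (Fin n))}
    (hF : ∀ y ∈ F, ∃ R > 0, ∀ r ≤ R, IsCompact (F ∩ Metric.closedBall y r))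
    (tX : ∀ j, IsTangentField F (X j))
    {V : EuclideanSpace ℝ (Fin n) → EuclideanSpace ℝ (Fin n)} (hV : GeneratedLieAlgebra X V) :
    ContDiff ℝ ∞ V ∧ IsTangentField F V := by
  induction hV with
  | generator j => exact ⟨hX j, tX j⟩
  | zero => exact ⟨contDiff_const, fun y _ ν _ => by simp⟩
  | add _ _ h1 h2 =>
    exact ⟨h1.1.add h2.1, fun y hy ν hν => by
      rw [Pi.add_apply, inner_add_left, h1.2 y hy ν hν, h2.2 y hy ν hν, add_zero]⟩
  | smul c _ h =>
    exact ⟨h.1.const_smul c, fun y hy ν hν => by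
      rw [Pi.smul_apply, inner_smul_left, h.2 y hy ν hν, mul_zero]⟩
  | bracket _ _ h1 h2 =>
    exact ⟨h1.1.lieBracket_vectorField h2.1 (by simp), IsTangentField.lieBracket hF
      (h1.1.of_le (by simp)) (h2.1.of_le (by simp)) h1.2 h2.2⟩

/-- Under Hörmander's condition, a relatively closed set with tangent generators has no nonzero
proximal normals. -/
lemma HormanderCondition.eq_zero_of_isProximalNormal {n m : ℕ}
    {Ω F : Set (EuclideanSpace ℝ (Fin n))}
    {X : Fin m → EuclideanSpace ℝ (Fin n) → EuclideanSpace ℝ (Fin n)}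
    (hX : ∀ j, ContDiff ℝ ∞ (X j)) (hrank : HormanderCondition Ω X) (hFΩ : F ⊆ Ω)
    (hF : ∀ y ∈ F, ∃ R > 0, ∀ r ≤ R, IsCompact (F ∩ Metric.closedBall y r))
    (tX : ∀ j, IsTangentField F (X j)) {y ν : EuclideanSpace ℝ (Fin n)} (hy : y ∈ F)
    (hν : IsProximalNormal F y ν) : ν = 0 := by
  have htop : Submodule.span ℝ {w : EuclideanSpace ℝ (Fin n) |
      ∃ V, GeneratedLieAlgebra X V ∧ w = V y} = ⊤ := by
    apply Submodule.eq_top_of_finrank_eq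
    rw [hrank y (hFΩ hy)]; simp
  have hmem : ν ∈ Submodule.span ℝ {w : EuclideanSpace ℝ (Fin n) |
      ∃ V, GeneratedLieAlgebra X V ∧ w = V y} := by rw [htop]; trivial
  have : ∀ w ∈ Submodule.span ℝ {w : EuclideanSpace ℝ (Fin n) |
      ∃ V, GeneratedLieAlgebra X V ∧ w = V y}, inner ℝ w ν = 0 := by
    intro w hw
    induction hw using Submodule.span_induction with
    | mem w h =>
      obtain ⟨V, hV, rfl⟩ := h
      exact (hV.contDiff_and_isTangentField hX hF tX).2 y hy ν hν
    | zero => simp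
    | add a b _ _ ha hb => rw [inner_add_left, ha, hb, add_zero]
    | smul c a _ ha => rw [inner_smul_left, ha, mul_zero]
  exact inner_self_eq_zero.1 (this ν hmem)

/-- A nonempty relatively closed subset of a connected open set without nonzero proximal
normals is the whole set. -/
lemma eq_of_forall_isProximalNormal_eq_zero {E : Type*} [NormedAddCommGroup E]
    [InnerProductSpace ℝ E] {Ω F : Set E}
    (hconn : IsConnected Ω) (hFΩ : F ⊆ Ω) (hne : F.Nonempty)
    (hclosed : IsOpen (Ω \ F))
    (hF : ∀ y ∈ F, ∃ R > 0, ∀ r ≤ R, IsCompact (F ∩ Metric.closedBall y r))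
    (hnormal : ∀ y ∈ F, ∀ ν, IsProximalNormal F y ν → ν = 0) : F = Ω := by
  have hopen : IsOpen F := by
    rw [Metric.isOpen_iff]
    intro y hy
    obtain ⟨R, hR, hc⟩ := hF y hy
    -- For `x` this close to `y`, a nearest point `π` of the truncated set is within `R / 2` of `y`,
    -- so truncation is invisible near `π` and `x - π` is a proximal normal of `F`; hence `x = π`.
    refine ⟨R / 4, by positivity, fun x hx => ?_⟩
    have hyK : y ∈ F ∩ Metric.closedBall y R := ⟨hy, by simp [hR.le]⟩
    obtain ⟨π, hπ, hd⟩ := (hc R le_rfl).exists_infDist_eq_dist ⟨y, hyK⟩ x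
    have hmin : ∀ z ∈ F ∩ Metric.closedBall y R, dist x π ≤ dist x z := fun z hz => by
      rw [← hd]; exact Metric.infDist_le_dist_of_mem hz
    rw [Metric.mem_ball] at hx
    have h1 : dist x π < R / 4 := (hmin y hyK).trans_lt hx
    have h2 : dist π y < R / 2 := by
      linarith [dist_triangle π x y, dist_comm π x]
    have : IsProximalNormal F π (x - π) := by
      apply isProximalNormal_of_nearest
      rw [eventually_nhdsWithin_iff]
      filter_upwards [Metric.ball_mem_nhds π (half_pos hR)] with z hz hzF
      rw [← dist_eq_norm, ← dist_eq_norm]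
      refine hmin z ⟨hzF, ?_⟩
      rw [Metric.mem_ball] at hz
      rw [Metric.mem_closedBall]
      linarith [dist_triangle z π y]
    have := hnormal π hπ.1 _ this
    rw [sub_eq_zero.1 this]
    exact hπ.1
  refine hFΩ.antisymm ?_
  by_contra hcon
  obtain ⟨z, hzΩ, hzF⟩ := not_subset.1 hcon
  obtain ⟨y, hy⟩ := hne
  obtain ⟨w, -, hw1, hw2⟩ := hconn.isPreconnected F (Ω \ F) hopen hclosed
    (fun x hx => by by_cases h : x ∈ F <;> simp [h, hx]) ⟨y, hFΩ hy, hy⟩ ⟨z, hzΩ, hzΩ, hzF⟩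
  exact hw2.2 hw1

/-! ### Increments from almost everywhere derivative bounds. -/

/-- A lower bound for the derivative of a Lipschitz function which holds almost everywhere gives
a lower bound for its increments. -/
lemma LipschitzOnWith.le_sub_of_ae_le_deriv {g : ℝ → ℝ} {K : NNReal} {k : ℝ}
    (hg : LipschitzOnWith K g (Icc 0 1))
    (hk : ∀ᵐ t : ℝ, t ∈ Icc (0 : ℝ) 1 → k ≤ deriv g t) : k ≤ g 1 - g 0 := by
  have hac : AbsolutelyContinuousOnInterval g 0 1 := by
    apply LipschitzOnWith.absolutelyContinuousOnInterval (K := K)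
    rwa [uIcc_of_le zero_le_one]
  rw [← hac.integral_deriv_eq_sub]
  have h1 : ∫ _ in (0 : ℝ)..1, k = k := by simp
  rw [← h1]
  refine intervalIntegral.integral_mono_ae_restrict zero_le_one (by simp)
    hac.intervalIntegrable_deriv ?_
  exact (ae_restrict_iff' measurableSet_Icc).2 hk

section AlmostEverywhereDerivative

variable {G : Type*} [NormedAddCommGroup G] [InnerProductSpace ℝ G] [FiniteDimensional ℝ G]
  [MeasurableSpace G] [BorelSpace G]

/-- A bound for the derivative of a locally Lipschitz map which holds almost everywhere near a
segment gives a bound for the increment along this segment. -/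
lemma LocallyLipschitzOn.le_inner_sub_of_ae {A : G → G} {U : Set G} (hU : IsOpen U)
    (hcont : Continuous A) (hLip : LocallyLipschitzOn U A) {ξ v e : G} {k : ℝ}
    (hseg : ∀ t ∈ Icc (0 : ℝ) 1, ξ + t • v ∈ U)
    (hae : ∀ᵐ z : G, z ∈ U → DifferentiableAt ℝ A z ∧ k ≤ inner ℝ (fderiv ℝ A z v) e) :
    k ≤ inner ℝ (A (ξ + v) - A ξ) e := by
  have hS : IsCompact ((fun t : ℝ => ξ + t • v) '' Icc 0 1) :=
    isCompact_Icc.image (by fun_prop)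
  obtain ⟨r, hr, hrU⟩ := hS.exists_thickening_subset_open hU
    (by rintro _ ⟨t, ht, rfl⟩; exact hseg t ht)
  have hmem : ∀ h : G, ‖h‖ < r → ∀ t ∈ Icc (0 : ℝ) 1, ξ + h + t • v ∈ U := by
    intro h hh t ht
    refine hrU (Metric.mem_thickening_iff.2 ⟨_, ⟨t, ht, rfl⟩, ?_⟩)
    rwa [dist_eq_norm, show ξ + h + t • v - (ξ + t • v) = h by module]
  set N := toMeasurable (volume : Measure G)
    {z | ¬(z ∈ U → DifferentiableAt ℝ A z ∧ k ≤ inner ℝ (fderiv ℝ A z v) e)} with hN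
  have hN0 : volume N = 0 := by rw [hN, measure_toMeasurable]; exact ae_iff.1 hae
  have hNm : MeasurableSet N := measurableSet_toMeasurable _ _
  have hgood : ∀ z ∉ N, z ∈ U → DifferentiableAt ℝ A z ∧ k ≤ inner ℝ (fderiv ℝ A z v) e := by
    intro z hz
    by_contra hcon
    exact hz (subset_toMeasurable _ _ hcon)
  -- The given segment may lie inside the exceptional null set, but by Fubini almost every translate
  -- of it meets that set only for a null set of parameters.
  have hae2 : ∀ᵐ h : G, ∀ᵐ t : ℝ, ξ + h + t • v ∉ N := by
    rw [Measure.ae_ae_comm]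
    · refine Eventually.of_forall fun t => ?_
      have hmp : MeasurePreserving (fun h : G => (ξ + t • v) + h) volume volume :=
        measurePreserving_add_left _ _
      have : ∀ᵐ z : G, z ∉ N := by simpa [ae_iff] using hN0
      filter_upwards [hmp.quasiMeasurePreserving.ae this] with h hh
      convert! hh using 2
      abel
    · have : Measurable fun x : G × ℝ => ξ + x.1 + x.2 • v := by fun_prop
      exact (this hNm).compl
  have hline : ∀ h : G, ‖h‖ < r → (∀ᵐ t : ℝ, ξ + h + t • v ∉ N) →
      k ≤ inner ℝ (A (ξ + h + v) - A (ξ + h)) e := by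
    intro h hh hht
    have hT : IsCompact ((fun t : ℝ => ξ + h + t • v) '' Icc 0 1) :=
      isCompact_Icc.image (by fun_prop)
    obtain ⟨L, hL⟩ := (hLip.mono (by rintro _ ⟨t, ht, rfl⟩; exact hmem h hh t ht :
      (fun t : ℝ => ξ + h + t • v) '' Icc 0 1 ⊆ U)).exists_lipschitzOnWith_of_compact hT
    have hg : LipschitzOnWith (L * ‖v‖₊ * ‖e‖₊) (fun t : ℝ => inner ℝ (A (ξ + h + t • v)) e)
        (Icc 0 1) := by
      refine LipschitzOnWith.of_dist_le_mul fun s hs t ht => ?_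
      have h1 := hL.dist_le_mul _ (mem_image_of_mem _ hs) _ (mem_image_of_mem _ ht)
      rw [dist_eq_norm, dist_eq_norm] at h1
      rw [Real.dist_eq, ← inner_sub_left]
      refine (abs_real_inner_le_norm _ _).trans ?_
      have h2 : ξ + h + s • v - (ξ + h + t • v) = (s - t) • v := by module
      rw [h2, norm_smul, Real.norm_eq_abs] at h1
      push_cast
      rw [Real.dist_eq]
      calc _ ≤ L * (|s - t| * ‖v‖) * ‖e‖ := by gcongr
        _ = _ := by ring
    have := hg.le_sub_of_ae_le_deriv (k := k) (by
      filter_upwards [hht] with t ht htI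
      obtain ⟨hd, hk⟩ := hgood _ ht (hmem h hh t htI)
      have hline : HasDerivAt (fun t : ℝ => ξ + h + t • v) v t := by
        simpa using ((hasDerivAt_id' t).smul_const v).const_add (ξ + h)
      have h1 := hd.hasFDerivAt.comp_hasDerivAt t hline
      have h2 : HasDerivAt (fun t : ℝ => inner ℝ (A (ξ + h + t • v)) e)
          (inner ℝ (fderiv ℝ A (ξ + h + t • v) v) e) t := by
        simpa using h1.inner ℝ (hasDerivAt_const t e)
      rw [h2.deriv]
      exact hk)
    simpa [inner_sub_left] using this
  -- Good translations are dense and the increment depends continuously on the translation, so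
  -- failure at `h = 0` would propagate to a good `h`.
  by_contra! hcon
  have hopen : IsOpen ({h : G | inner ℝ (A (ξ + h + v) - A (ξ + h)) e < k} ∩ Metric.ball 0 r) :=
    (isOpen_lt (by fun_prop) continuous_const).inter Metric.isOpen_ball
  obtain ⟨h, ⟨h1, h2⟩, h3⟩ := (Measure.dense_of_ae hae2).inter_open_nonempty _ hopen
    ⟨0, by simpa using hcon, by simpa using hr⟩
  exact absurd (hline h (by simpa using h2) h3) (not_le.2 h1)

end AlmostEverywhereDerivative

/-! ### Comparison of the weights `(κ + s) ^ (p - 2)`. -/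

section Weights

lemma rpow_le_four_rpow_mul {a b q : ℝ} (ha : 0 < a) (hab : a ≤ 4 * b) (hba : b ≤ 4 * a) :
    a ^ q ≤ 4 ^ |q| * b ^ q := by
  have hb : 0 < b := by linarith
  rcases le_total 0 q with hq | hq
  · rw [abs_of_nonneg hq, ← Real.mul_rpow (by norm_num) hb.le]
    exact Real.rpow_le_rpow ha.le hab hq
  · rw [abs_of_nonpos hq, Real.rpow_neg (by norm_num), inv_mul_eq_div, le_div_iff₀ (by positivity),
      mul_comm, ← Real.mul_rpow (by norm_num) ha.le]
    exact Real.rpow_le_rpow_of_nonpos hb hba hq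

/-- The function `s ↦ (κ + s) ^ (p - 2) * s` is nondecreasing for `p > 1`. -/
lemma monotoneOn_add_rpow_mul {κ p : ℝ} (hκ : 0 ≤ κ) (hp : 1 < p) :
    MonotoneOn (fun s : ℝ => (κ + s) ^ (p - 2) * s) (Ici 0) := by
  intro s hs t ht hst
  rcases (show (0 : ℝ) ≤ s from hs).eq_or_lt with h0 | h0
  · have ht' : (0 : ℝ) ≤ t := ht
    simp only [← h0, mul_zero]
    positivity
  have ht0 : 0 < t := h0.trans_le hst
  -- The exponent `p - 2` may be negative; this rewriting exhibits a product of two nonnegative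
  -- nondecreasing functions.
  have key : ∀ x : ℝ, 0 < x → (κ + x) ^ (p - 2) * x = (κ + x) ^ (p - 1) * (x / (κ + x)) := by
    intro x hx
    rw [show p - 2 = (p - 1) - 1 by ring, Real.rpow_sub_one (by positivity)]
    field_simp
  simp only [key s h0, key t ht0]
  refine mul_le_mul (Real.rpow_le_rpow (by positivity) (by linarith) (by linarith)) ?_
    (by positivity) (by positivity)
  rw [div_le_div_iff₀ (by positivity) (by positivity)]
  nlinarith

/-- For `p > 1` the factor is below `1`, so the growth of `A` along the points `ξ / 2 ^ N` sums as a
geometric series. When `p ≤ 2` one uses `κ + s / 2 ≥ (κ + s) / 2`. -/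
lemma add_half_rpow_mul_le {κ p s : ℝ} (hκ : 0 ≤ κ) (hs : 0 < s) :
    (κ + s / 2) ^ (p - 2) * (s / 2) ≤ max (1 / 2) (2 ^ (1 - p)) * ((κ + s) ^ (p - 2) * s) := by
  have hpos : 0 < (κ + s) ^ (p - 2) * s := by positivity
  rcases le_total 2 p with h | h
  · calc (κ + s / 2) ^ (p - 2) * (s / 2) ≤ (κ + s) ^ (p - 2) * (s / 2) := by
          gcongr
          linarith
      _ = 1 / 2 * ((κ + s) ^ (p - 2) * s) := by ring
      _ ≤ _ := by gcongr; exact le_max_left _ _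
  · calc (κ + s / 2) ^ (p - 2) * (s / 2) ≤ ((κ + s) / 2) ^ (p - 2) * (s / 2) := by
          gcongr ?_ * _
          exact Real.rpow_le_rpow_of_nonpos (by positivity) (by linarith) (by linarith)
      _ = 2 ^ (1 - p) * ((κ + s) ^ (p - 2) * s) := by
          rw [Real.div_rpow (by positivity) (by norm_num), show 1 - p = -(p - 2) - 1 by ring,
            Real.rpow_sub_one (by norm_num), Real.rpow_neg (by norm_num)]
          field_simp
      _ ≤ _ := by gcongr; exact le_max_right _ _

end Weights

/-! ### Monotonicity, growth and increments of `A`. -/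

namespace StructureConditions

variable {m : ℕ} {p κ β γ : ℝ} {A : EuclideanSpace ℝ (Fin m) → EuclideanSpace ℝ (Fin m)}

lemma inner_fderiv_eq_sum (B : EuclideanSpace ℝ (Fin m) → EuclideanSpace ℝ (Fin m))
    (z v e : EuclideanSpace ℝ (Fin m)) :
    inner ℝ (fderiv ℝ B z v) e = ∑ i, ∑ j, partialDerivComponent B i j z * v i * e j := by
  have hv : v = ∑ i, v i • EuclideanSpace.single i (1 : ℝ) := by
    ext k
    simp [Pi.single_apply]
  conv_lhs => rw [hv]
  rw [map_sum, sum_inner]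
  refine Finset.sum_congr rfl fun i _ => ?_
  rw [map_smul, inner_smul_left, PiLp.inner_apply, Finset.mul_sum]
  refine Finset.sum_congr rfl fun j _ => ?_
  simp [partialDerivComponent]
  ring

/-- The structure conditions in terms of the Fréchet derivative. -/
lemma ae_fderiv (hA : StructureConditions p κ β γ A) (hκ : 0 ≤ κ) (hβ : 0 < β)
    {v : EuclideanSpace ℝ (Fin m)} (hv : v ≠ 0) :
    ∀ᵐ z : EuclideanSpace ℝ (Fin m), z ≠ 0 → DifferentiableAt ℝ A z ∧
      β * (κ + ‖z‖) ^ (p - 2) * ‖v‖ ^ 2 ≤ inner ℝ (fderiv ℝ A z v) v ∧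
      ∀ e, |inner ℝ (fderiv ℝ A z v) e| ≤ γ * (κ + ‖z‖) ^ (p - 2) * (‖v‖ * ‖e‖) := by
  filter_upwards [hA.ellipticity, hA.growth] with z h1 h2 hz
  have hz' : 0 < ‖z‖ := norm_pos_iff.2 hz
  have hv' : 0 < ‖v‖ := norm_pos_iff.2 hv
  have e1 : β * (κ + ‖z‖) ^ (p - 2) * ‖v‖ ^ 2 ≤ inner ℝ (fderiv ℝ A z v) v := by
    rw [inner_fderiv_eq_sum]; exact h1 v
  refine ⟨?_, e1, fun e => ?_⟩
  · by_contra hnd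
    rw [fderiv_zero_of_not_differentiableAt hnd] at e1
    have : 0 < β * (κ + ‖z‖) ^ (p - 2) * ‖v‖ ^ 2 := by positivity
    simp only [zero_apply, inner_zero_left] at e1
    linarith
  · rw [inner_fderiv_eq_sum]
    calc |∑ i, ∑ j, partialDerivComponent A i j z * v i * e j|
        ≤ ∑ i, ∑ j, |partialDerivComponent A i j z| * (‖v‖ * ‖e‖) := by
          refine (Finset.abs_sum_le_sum_abs _ _).trans (Finset.sum_le_sum fun i _ => ?_)
          refine (Finset.abs_sum_le_sum_abs _ _).trans (Finset.sum_le_sum fun j _ => ?_)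
          rw [abs_mul, abs_mul, mul_assoc]
          gcongr
          · exact PiLp.norm_apply_le v i
          · exact PiLp.norm_apply_le e j
      _ = (∑ i, ∑ j, |partialDerivComponent A i j z|) * (‖v‖ * ‖e‖) := by
          simp_rw [Finset.sum_mul]
      _ ≤ _ := by gcongr

/-- Ellipticity and growth for increments which are small with respect to the base point. -/
lemma increment_bounds (hA : StructureConditions p κ β γ A) (hκ : 0 ≤ κ) (hβ : 0 < β)
    (hγ : 0 < γ) {ξ v : EuclideanSpace ℝ (Fin m)} (hξ : ξ ≠ 0) (hv : ‖v‖ ≤ ‖ξ‖ / 2) :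
    β / 4 ^ |p - 2| * (κ + ‖ξ‖) ^ (p - 2) * ‖v‖ ^ 2 ≤ inner ℝ (A (ξ + v) - A ξ) v ∧
      ‖A (ξ + v) - A ξ‖ ≤ γ * 4 ^ |p - 2| * (κ + ‖ξ‖) ^ (p - 2) * ‖v‖ := by
  rcases eq_or_ne v 0 with rfl | hv0
  · simp
  have hξ' : 0 < ‖ξ‖ := norm_pos_iff.2 hξ
  set c : ℝ := 4 ^ |p - 2| with hc
  have hc0 : 0 < c := by positivity
  -- In this annulus the weight is comparable with its value at `ξ`, and the segment from `ξ` to `ξ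
  -- + v` stays inside since `‖v‖ ≤ ‖ξ‖ / 2`.
  set U : Set (EuclideanSpace ℝ (Fin m)) := {z | ‖ξ‖ / 4 < ‖z‖ ∧ ‖z‖ < 4 * ‖ξ‖} with hU
  have hUo : IsOpen U := (isOpen_lt continuous_const continuous_norm).inter
    (isOpen_lt continuous_norm continuous_const)
  have hU0 : ∀ z ∈ U, z ≠ 0 := fun z hz h0 => by
    have := hz.1; rw [h0, norm_zero] at this; linarith
  have hLip : LocallyLipschitzOn U A := hA.locallyLipschitz.mono fun z hz => hU0 z hz
  have hseg : ∀ t ∈ Icc (0 : ℝ) 1, ξ + t • v ∈ U := by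
    intro t ht
    have h1 : ‖t • v‖ ≤ ‖ξ‖ / 2 := by
      rw [norm_smul, Real.norm_of_nonneg ht.1]
      exact (mul_le_of_le_one_left (norm_nonneg _) ht.2).trans hv
    have h2 := norm_sub_le_norm_add ξ (t • v)
    have h3 := norm_add_le ξ (t • v)
    exact ⟨by linarith, by linarith⟩
  have hW : ∀ z ∈ U, (κ + ‖ξ‖) ^ (p - 2) / c ≤ (κ + ‖z‖) ^ (p - 2) ∧
      (κ + ‖z‖) ^ (p - 2) ≤ c * (κ + ‖ξ‖) ^ (p - 2) := by
    intro z hz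
    have hz1 := hz.1
    have hz2 := hz.2
    refine ⟨?_, rpow_le_four_rpow_mul (by linarith) (by linarith) (by linarith)⟩
    rw [div_le_iff₀' hc0]
    exact rpow_le_four_rpow_mul (by positivity) (by linarith) (by linarith)
  have hae := hA.ae_fderiv hκ hβ hv0
  constructor
  · refine hLip.le_inner_sub_of_ae hUo hA.continuous hseg ?_
    filter_upwards [hae] with z hz hzU
    obtain ⟨h1, h2, -⟩ := hz (hU0 z hzU)
    refine ⟨h1, le_trans ?_ h2⟩
    rw [div_mul_eq_mul_div, mul_div_assoc]
    gcongr
    exact (hW z hzU).1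
  · have key : ∀ e, -(γ * (c * (κ + ‖ξ‖) ^ (p - 2)) * (‖v‖ * ‖e‖)) ≤
        inner ℝ (A (ξ + v) - A ξ) e := by
      intro e
      refine hLip.le_inner_sub_of_ae hUo hA.continuous hseg ?_
      filter_upwards [hae] with z hz hzU
      obtain ⟨h1, -, h2⟩ := hz (hU0 z hzU)
      refine ⟨h1, le_trans ?_ (neg_le_of_abs_le (h2 e))⟩
      gcongr
      exact (hW z hzU).2
    -- Testing against the negative increment turns the lower bound into a bound on its norm.
    have h := key (-(A (ξ + v) - A ξ))
    rw [inner_neg_right, real_inner_self_eq_norm_sq, norm_neg] at h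
    rcases (norm_nonneg (A (ξ + v) - A ξ)).eq_or_lt with h0 | h0
    · rw [← h0]; positivity
    · have h' : ‖A (ξ + v) - A ξ‖ * ‖A (ξ + v) - A ξ‖ ≤
          (γ * c * (κ + ‖ξ‖) ^ (p - 2) * ‖v‖) * ‖A (ξ + v) - A ξ‖ := by nlinarith
      exact le_of_mul_le_mul_right h' h0

/-- `A` is monotone. -/
lemma inner_sub_nonneg (hA : StructureConditions p κ β γ A) (hκ : 0 ≤ κ) (hβ : 0 < β)
    (ξ η : EuclideanSpace ℝ (Fin m)) : 0 ≤ inner ℝ (A η - A ξ) (η - ξ) := by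
  have away : ∀ ξ v : EuclideanSpace ℝ (Fin m), (∀ t ∈ Icc (0 : ℝ) 1, ξ + t • v ≠ 0) →
      0 ≤ inner ℝ (A (ξ + v) - A ξ) v := by
    intro ξ v hseg
    rcases eq_or_ne v 0 with rfl | hv0
    · simp
    refine hA.locallyLipschitz.le_inner_sub_of_ae isOpen_compl_singleton hA.continuous hseg ?_
    filter_upwards [hA.ae_fderiv hκ hβ hv0] with z hz hz0
    obtain ⟨h1, h2, -⟩ := hz hz0
    exact ⟨h1, le_trans (by positivity) h2⟩
  have radial : ∀ ξ : EuclideanSpace ℝ (Fin m), 0 ≤ inner ℝ (A ξ) ξ := by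
    intro ξ
    rcases eq_or_ne ξ 0 with rfl | hξ
    · simp
    have hlim : Tendsto (fun t : ℝ => inner ℝ (A ξ - A (t • ξ)) ξ) (𝓝[>] 0)
        (𝓝 (inner ℝ (A ξ) ξ)) := by
      have hc : Continuous fun t : ℝ => inner ℝ (A ξ - A (t • ξ)) ξ := by
        have := hA.continuous
        fun_prop
      have := (hc.tendsto 0).mono_left (nhdsWithin_le_nhds (s := Ioi 0))
      simpa [hA.map_zero] using this
    refine ge_of_tendsto hlim ?_
    filter_upwards [Ioo_mem_nhdsGT (zero_lt_one' ℝ)] with t ht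
    have h1 := away (t • ξ) ((1 - t) • ξ) (fun s hs => by
      rw [smul_smul, ← add_smul]
      refine smul_ne_zero ?_ hξ
      have h3 : 0 ≤ s * (1 - t) := mul_nonneg hs.1 (by linarith [ht.2])
      exact ne_of_gt (by linarith [ht.1]))
    rw [← add_smul, add_sub_cancel, one_smul, inner_smul_right] at h1
    exact nonneg_of_mul_nonneg_right h1 (by linarith [ht.2])
  -- A segment through the origin leaves the region where `A` is locally Lipschitz. Its endpoints
  -- are then multiples of `η - ξ` on opposite sides of `0` (or `0` itself), and `radial` applies to
  -- each.
  by_cases h : ∃ t ∈ Icc (0 : ℝ) 1, ξ + t • (η - ξ) = 0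
  · obtain ⟨t, ht, h0⟩ := h
    set v := η - ξ with hv
    have hξ : ξ = -(t • v) := eq_neg_of_add_eq_zero_left h0
    have hη : η = (1 - t) • v := by
      have : η = ξ + v := by rw [hv]; abel
      rw [this, hξ]; module
    rw [inner_sub_left]
    have h1 : 0 ≤ inner ℝ (A η) v := by
      rcases ht.2.eq_or_lt with h | h
      · rw [hη, h]; simp [hA.map_zero]
      · have := radial η
        nth_rewrite 2 [hη] at this
        rw [inner_smul_right] at this
        exact nonneg_of_mul_nonneg_right this (by linarith)
    have h2 : inner ℝ (A ξ) v ≤ 0 := by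
      rcases ht.1.eq_or_lt with h | h
      · rw [hξ, ← h]; simp [hA.map_zero]
      · have := radial ξ
        nth_rewrite 2 [hξ] at this
        rw [inner_neg_right, inner_smul_right] at this
        nlinarith
    linarith
  · push Not at h
    have := away ξ (η - ξ) h
    rwa [add_sub_cancel] at this

/-- The growth of `A`. -/
lemma exists_norm_le (hA : StructureConditions p κ β γ A) (hκ : 0 ≤ κ) (hβ : 0 < β)
    (hγ : 0 < γ) (hp : 1 < p) :
    ∃ C : ℝ, 0 ≤ C ∧ ∀ ξ, ‖A ξ‖ ≤ C * ((κ + ‖ξ‖) ^ (p - 2) * ‖ξ‖) := by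
  set c : ℝ := γ * 4 ^ |p - 2| / 2 with hc
  have hc0 : 0 < c := by positivity
  set q : ℝ := max (1 / 2) (2 ^ (1 - p)) with hq
  have hq0 : 0 < q := lt_max_of_lt_left (by norm_num)
  have hq1 : q < 1 := max_lt (by norm_num)
    (Real.rpow_lt_one_of_one_lt_of_neg (by norm_num) (by linarith))
  have hq2 : 0 < 1 - q := by linarith
  refine ⟨c / (1 - q), by positivity, fun ξ => ?_⟩
  rcases eq_or_ne ξ 0 with rfl | hξ
  · simp [hA.map_zero]
  have step : ∀ ξ : EuclideanSpace ℝ (Fin m), ξ ≠ 0 →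
      ‖A ξ‖ ≤ c * ((κ + ‖ξ‖) ^ (p - 2) * ‖ξ‖) + ‖A ((1 / 2 : ℝ) • ξ)‖ := by
    intro ξ hξ
    have hn : ‖-((1 / 2 : ℝ) • ξ)‖ = ‖ξ‖ / 2 := by
      rw [norm_neg, norm_smul]; norm_num; ring
    have h := (hA.increment_bounds hκ hβ hγ hξ hn.le).2
    rw [hn, show ξ + -((1 / 2 : ℝ) • ξ) = (1 / 2 : ℝ) • ξ by module] at h
    have h2 := norm_sub_norm_le (A ξ) (A ((1 / 2 : ℝ) • ξ))
    rw [norm_sub_rev] at h2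
    have h3 : γ * 4 ^ |p - 2| * (κ + ‖ξ‖) ^ (p - 2) * (‖ξ‖ / 2) =
      c * ((κ + ‖ξ‖) ^ (p - 2) * ‖ξ‖) := by rw [hc]; ring
    linarith
  -- The constant `c / (1 - q)` is the fixed point of one halving step, `c + q * (c / (1 - q)) = c /
  -- (1 - q)`. As `N` grows the remainder tends to `A 0 = 0`.
  have iter : ∀ N : ℕ, ∀ ξ : EuclideanSpace ℝ (Fin m), ξ ≠ 0 →
      ‖A ξ‖ ≤ c / (1 - q) * ((κ + ‖ξ‖) ^ (p - 2) * ‖ξ‖) + ‖A ((1 / 2 : ℝ) ^ N • ξ)‖ := by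
    intro N
    induction N with
    | zero =>
      intro ξ hξ
      simp only [pow_zero, one_smul]
      have : 0 ≤ c / (1 - q) * ((κ + ‖ξ‖) ^ (p - 2) * ‖ξ‖) := by positivity
      linarith
    | succ N ih =>
      intro ξ hξ
      have h1 := step ξ hξ
      have h2 := ih ((1 / 2 : ℝ) • ξ) (smul_ne_zero (by norm_num) hξ)
      have hn : ‖(1 / 2 : ℝ) • ξ‖ = ‖ξ‖ / 2 := by rw [norm_smul]; norm_num; ring
      rw [smul_smul, ← pow_succ, hn] at h2
      have h3 := add_half_rpow_mul_le (p := p) hκ (norm_pos_iff.2 hξ)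
      have h4 := mul_le_mul_of_nonneg_left h3 (show 0 ≤ c / (1 - q) by positivity)
      set T := (κ + ‖ξ‖) ^ (p - 2) * ‖ξ‖ with hT
      have h5 : c * T + c / (1 - q) * (q * T) = c / (1 - q) * T := by field_simp; ring
      linarith
  have hlim : Tendsto (fun N : ℕ => c / (1 - q) * ((κ + ‖ξ‖) ^ (p - 2) * ‖ξ‖) +
      ‖A ((1 / 2 : ℝ) ^ N • ξ)‖) atTop
      (𝓝 (c / (1 - q) * ((κ + ‖ξ‖) ^ (p - 2) * ‖ξ‖))) := by
    have h1 : Tendsto (fun N : ℕ => (1 / 2 : ℝ) ^ N • ξ) atTop (𝓝 0) := by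
      have := (tendsto_pow_atTop_nhds_zero_of_lt_one (r := (1 / 2 : ℝ)) (by norm_num)
        (by norm_num)).smul_const ξ
      rwa [zero_smul] at this
    have h2 := ((hA.continuous.tendsto 0).comp h1).norm
    rw [hA.map_zero, norm_zero] at h2
    simpa using h2.const_add (c / (1 - q) * ((κ + ‖ξ‖) ^ (p - 2) * ‖ξ‖))
  exact ge_of_tendsto' hlim fun N => iter N ξ hξ

end StructureConditions

/-! ### Mollification of `A`. -/

/-- A lower bound for increments along a line gives a lower bound for the derivative. -/
lemma le_inner_of_hasFDerivAt {G : Type*} [NormedAddCommGroup G]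
    [InnerProductSpace ℝ G] {B : G → G} {B' : G →L[ℝ] G} {ξ v : G} {k : ℝ}
    (hB : HasFDerivAt B B' ξ)
    (h : ∀ᶠ t in 𝓝[>] (0 : ℝ), k * t ^ 2 ≤ inner ℝ (B (ξ + t • v) - B ξ) (t • v)) :
    k ≤ inner ℝ (B' v) v := by
  have hline : HasDerivAt (fun t : ℝ => ξ + t • v) v 0 := by
    simpa using ((hasDerivAt_id' (0 : ℝ)).smul_const v).const_add ξ
  have hB0 : HasFDerivAt B B' (ξ + (0 : ℝ) • v) := by simpa using hB
  have h2 : HasDerivAt (fun t : ℝ => inner ℝ (B (ξ + t • v)) v) (inner ℝ (B' v) v) 0 := by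
    simpa using (hB0.comp_hasDerivAt 0 hline).inner ℝ (hasDerivAt_const 0 v)
  have hs := (hasDerivAt_iff_tendsto_slope.1 h2).mono_left
    (nhdsWithin_mono 0 (fun z (hz : z ∈ Ioi (0 : ℝ)) => (ne_of_gt hz : z ≠ 0)))
  refine ge_of_tendsto hs ?_
  filter_upwards [h, self_mem_nhdsWithin] with t ht ht0
  have ht0 : 0 < t := ht0
  rw [slope_def_field, le_div_iff₀ (by simpa using ht0)]
  rw [inner_smul_right, inner_sub_left] at ht
  simp only [zero_smul, add_zero, sub_zero]
  nlinarith

lemma HasCompactSupport.integrable_smul_comp_const_sub {G : Type*} [NormedAddCommGroup G]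
    [NormedSpace ℝ G] [MeasurableSpace G] [BorelSpace G]
    {μ : Measure G} [IsFiniteMeasureOnCompacts μ] {ρ : G → ℝ} {A : G → G} (hρ : Continuous ρ)
    (hρc : HasCompactSupport ρ) (hA : Continuous A) (ξ : G) :
    Integrable (fun z => ρ z • A (ξ - z)) μ :=
  (hρ.smul (hA.comp (by fun_prop))).integrable_of_hasCompactSupport hρc.smul_right

/-- Smooth approximations of `A` which satisfy the structure conditions away from the origin. -/
lemma StructureConditions.exists_smooth_approximation {m : ℕ} {p κ β γ : ℝ}
    {A : EuclideanSpace ℝ (Fin m) → EuclideanSpace ℝ (Fin m)}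
    (hA : StructureConditions p κ β γ A) (hκ : 0 ≤ κ) (hβ : 0 < β) (hγ : 0 < γ)
    {μ τ : ℝ} (hμ : 0 < μ) (hτ : 0 < τ) (R : ℝ) :
    ∃ B : EuclideanSpace ℝ (Fin m) → EuclideanSpace ℝ (Fin m), ContDiff ℝ ∞ B ∧
      (∀ ξ, ‖ξ‖ ≤ R → ‖B ξ - A ξ‖ ≤ τ) ∧
      ∀ ξ, μ ≤ ‖ξ‖ → ∀ v,
        β / (4 ^ |p - 2| * 4 ^ |p - 2|) * (κ + ‖ξ‖) ^ (p - 2) * ‖v‖ ^ 2 ≤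
          inner ℝ (fderiv ℝ B ξ v) v ∧
        ‖fderiv ℝ B ξ v‖ ≤ γ * (4 ^ |p - 2| * 4 ^ |p - 2|) * (κ + ‖ξ‖) ^ (p - 2) * ‖v‖ := by
  set c : ℝ := 4 ^ |p - 2| with hc
  have hc0 : 0 < c := by positivity
  obtain ⟨δ, hδ, hunif⟩ := Metric.uniformContinuousOn_iff.1
    ((isCompact_closedBall (0 : EuclideanSpace ℝ (Fin m)) (|R| + 1)).uniformContinuousOn_of_continuous
      hA.continuous.continuousOn) τ hτ
  -- The bound `μ / 2` keeps the averaging away from the origin: if `‖ξ‖ ≥ μ`, then `‖ξ - z‖` is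
  -- between `‖ξ‖ / 2` and `2 * ‖ξ‖`. The bounds `δ` and `1` serve uniform closeness to `A`.
  set r := min (min δ 1) (μ / 2) with hr
  have hr0 : 0 < r := lt_min (lt_min hδ one_pos) (by positivity)
  have hrδ : r ≤ δ := (min_le_left _ _).trans (min_le_left _ _)
  have hr1 : r ≤ 1 := (min_le_left _ _).trans (min_le_right _ _)
  have hrμ : r ≤ μ / 2 := min_le_right _ _
  let φ : ContDiffBump (0 : EuclideanSpace ℝ (Fin m)) := ⟨r / 2, r, by positivity, by linarith⟩
  set ρ := φ.normed volume with hρ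
  have hρcs : HasCompactSupport ρ := φ.hasCompactSupport_normed
  have hρcd : ContDiff ℝ ∞ ρ := φ.contDiff_normed
  have hρint : ∫ z, ρ z = 1 := φ.integral_normed
  have hρ0 : ∀ z, 0 ≤ ρ z := φ.nonneg_normed
  have hρsupp : ∀ z, ρ z ≠ 0 → ‖z‖ < r := by
    intro z hz
    have : z ∈ Function.support (φ.normed volume) := hz
    rw [φ.support_normed_eq] at this
    simpa using this
  have hρI : Integrable ρ := hρcd.continuous.integrable_of_hasCompactSupport hρcs
  set B := convolution ρ A (ContinuousLinearMap.lsmul ℝ ℝ) volume with hB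
  have hBdef : ∀ ξ, B ξ = ∫ z, ρ z • A (ξ - z) := fun ξ => rfl
  have hBsm : ContDiff ℝ ∞ B := hρcs.contDiff_convolution_left _ hρcd
    hA.continuous.locallyIntegrable
  have hInt : ∀ ξ, Integrable (fun z => ρ z • A (ξ - z)) := fun ξ =>
    hρcs.integrable_smul_comp_const_sub hρcd.continuous hA.continuous ξ
  have hBinc : ∀ ξ v, B (ξ + v) - B ξ = ∫ z, ρ z • (A (ξ - z + v) - A (ξ - z)) := by
    intro ξ v
    rw [hBdef, hBdef, ← integral_sub (hInt _) (hInt _)]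
    refine integral_congr_ae (Eventually.of_forall fun z => ?_)
    simp only
    rw [← smul_sub, show ξ + v - z = ξ - z + v by abel]
  have hIntInc : ∀ ξ v, Integrable (fun z => ρ z • (A (ξ - z + v) - A (ξ - z))) := by
    intro ξ v
    refine ((hInt (ξ + v)).sub (hInt ξ)).congr (Eventually.of_forall fun z => ?_)
    simp only [Pi.sub_apply]
    rw [← smul_sub, show ξ + v - z = ξ - z + v by abel]
  refine ⟨B, hBsm, fun ξ hξ => ?_, fun ξ hξ => ?_⟩
  · rw [← dist_eq_norm]
    refine φ.dist_normed_convolution_le hA.continuous.aestronglyMeasurable fun x hx => ?_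
    have hx : dist x ξ < r := hx
    have h1 : dist ξ 0 ≤ |R| := by rw [dist_zero_right]; exact hξ.trans (le_abs_self R)
    refine (hunif x ?_ ξ ?_ (hx.trans_le hrδ)).le
    · rw [Metric.mem_closedBall]
      linarith [dist_triangle x ξ 0]
    · rw [Metric.mem_closedBall]
      linarith
  · have hξ0 : 0 < ‖ξ‖ := hμ.trans_le hξ
    have hz : ∀ z, ‖z‖ < r → ‖ξ‖ / 2 ≤ ‖ξ - z‖ ∧ ‖ξ - z‖ ≤ 2 * ‖ξ‖ := by
      intro z hz
      have h1 := norm_sub_norm_le ξ z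
      have h2 := norm_sub_le ξ z
      exact ⟨by linarith, by linarith⟩
    have hW : ∀ z, ‖z‖ < r → (κ + ‖ξ‖) ^ (p - 2) / c ≤ (κ + ‖ξ - z‖) ^ (p - 2) ∧
        (κ + ‖ξ - z‖) ^ (p - 2) ≤ c * (κ + ‖ξ‖) ^ (p - 2) := by
      intro z hzr
      obtain ⟨h1, h2⟩ := hz z hzr
      refine ⟨?_, rpow_le_four_rpow_mul (by linarith) (by linarith) (by linarith)⟩
      rw [div_le_iff₀' hc0]
      exact rpow_le_four_rpow_mul (by positivity) (by linarith) (by linarith)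
    -- One factor `c` comes from `increment_bounds` at `ξ - z`, the other from moving the weight
    -- from `ξ - z` to `ξ`. The condition on `v` ensures `‖v‖ ≤ ‖ξ - z‖ / 2`.
    have hinc : ∀ v, ‖v‖ ≤ ‖ξ‖ / 4 → ∀ z, ‖z‖ < r →
        β / (c * c) * (κ + ‖ξ‖) ^ (p - 2) * ‖v‖ ^ 2 ≤ inner ℝ (A (ξ - z + v) - A (ξ - z)) v ∧
        ‖A (ξ - z + v) - A (ξ - z)‖ ≤ γ * (c * c) * (κ + ‖ξ‖) ^ (p - 2) * ‖v‖ := by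
      intro v hv z hzr
      obtain ⟨h1, h2⟩ := hz z hzr
      obtain ⟨w1, w2⟩ := hW z hzr
      obtain ⟨i1, i2⟩ := hA.increment_bounds hκ hβ hγ (ξ := ξ - z) (v := v)
        (norm_pos_iff.1 (by linarith)) (by linarith)
      constructor
      · refine le_trans ?_ i1
        calc β / (c * c) * (κ + ‖ξ‖) ^ (p - 2) * ‖v‖ ^ 2
            = β / c * ((κ + ‖ξ‖) ^ (p - 2) / c) * ‖v‖ ^ 2 := by field_simp
          _ ≤ _ := by gcongr
      · refine i2.trans ?_
        calc γ * c * (κ + ‖ξ - z‖) ^ (p - 2) * ‖v‖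
            ≤ γ * c * (c * (κ + ‖ξ‖) ^ (p - 2)) * ‖v‖ := by gcongr
          _ = _ := by ring
    have hder : HasFDerivAt B (fderiv ℝ B ξ) ξ :=
      ((hBsm.differentiable (by simp)) ξ).hasFDerivAt
    intro v
    constructor
    · refine le_inner_of_hasFDerivAt hder ?_
      have hsmall : Tendsto (fun t : ℝ => t • v) (𝓝[>] 0) (𝓝 0) := by
        have : Tendsto (fun t : ℝ => t • v) (𝓝 0) (𝓝 ((0 : ℝ) • v)) :=
          (continuous_id.smul continuous_const).tendsto 0
        rw [zero_smul] at this
        exact this.mono_left nhdsWithin_le_nhds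
      filter_upwards [hsmall.norm.eventually (ge_mem_nhds (show ‖(0 : EuclideanSpace ℝ (Fin m))‖ <
        ‖ξ‖ / 4 by rw [norm_zero]; positivity))] with t ht
      rw [hBinc, real_inner_comm, ← integral_inner (hIntInc ξ (t • v))]
      set k := β / (c * c) * (κ + ‖ξ‖) ^ (p - 2) * ‖v‖ ^ 2 with hk
      have h1 : k * t ^ 2 = ∫ z, ρ z * (k * t ^ 2) := by
        rw [integral_mul_const, hρint, one_mul]
      rw [h1]
      refine integral_mono (hρI.mul_const _) ((hIntInc ξ (t • v)).const_inner _) fun z => ?_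
      simp only
      rw [inner_smul_right]
      rcases eq_or_ne (ρ z) 0 with h0 | h0
      · simp [h0]
      refine mul_le_mul_of_nonneg_left ?_ (hρ0 z)
      have h2 := (hinc (t • v) ht z (hρsupp z h0)).1
      rw [real_inner_comm]
      refine le_trans (le_of_eq ?_) h2
      rw [norm_smul, mul_pow, Real.norm_eq_abs, sq_abs, hk]
      ring
    · have hop : ‖fderiv ℝ B ξ‖ ≤ γ * (c * c) * (κ + ‖ξ‖) ^ (p - 2) := by
        refine hder.le_of_lip' (by positivity) ?_
        filter_upwards [Metric.closedBall_mem_nhds ξ (show 0 < ‖ξ‖ / 4 by positivity)] with x hx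
        rw [Metric.mem_closedBall, dist_eq_norm] at hx
        have h1 := hBinc ξ (x - ξ)
        rw [add_sub_cancel] at h1
        rw [h1]
        set k := γ * (c * c) * (κ + ‖ξ‖) ^ (p - 2) * ‖x - ξ‖ with hk
        have h2 : k = ∫ z, ρ z * k := by rw [integral_mul_const, hρint, one_mul]
        rw [h2]
        refine norm_integral_le_of_norm_le (hρI.mul_const _) (Eventually.of_forall fun z => ?_)
        rw [norm_smul, Real.norm_of_nonneg (hρ0 z)]
        rcases eq_or_ne (ρ z) 0 with h0 | h0
        · simp [h0]
        exact mul_le_mul_of_nonneg_left (hinc _ hx z (hρsupp z h0)).2 (hρ0 z)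
      exact (ContinuousLinearMap.le_opNorm _ _).trans (by gcongr)

/-! ### Divergence and integration by parts. -/

section Divergence

variable {n : ℕ}

/-- The divergence of a vector field. -/
noncomputable def divergence (Z : EuclideanSpace ℝ (Fin n) → EuclideanSpace ℝ (Fin n))
    (x : EuclideanSpace ℝ (Fin n)) : ℝ :=
  ∑ k, fderiv ℝ Z x (EuclideanSpace.single k 1) k

lemma continuous_divergence {Z : EuclideanSpace ℝ (Fin n) → EuclideanSpace ℝ (Fin n)}
    (hZ : ContDiff ℝ 1 Z) : Continuous (divergence Z) := by
  unfold divergence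
  refine continuous_finsetSum _ fun k _ => ?_
  have h1 : Continuous fun x => fderiv ℝ Z x (EuclideanSpace.single k 1) :=
    (hZ.continuous_fderiv one_ne_zero).clm_apply continuous_const
  fun_prop

lemma EuclideanSpace.eq_sum_smul_single (v : EuclideanSpace ℝ (Fin n)) :
    v = ∑ i, v i • EuclideanSpace.single i (1 : ℝ) := by
  ext k
  simp [Pi.single_apply]

lemma fderiv_coord_apply {E : Type*} [NormedAddCommGroup E] [NormedSpace ℝ E]
    {g : E → EuclideanSpace ℝ (Fin n)} {x : E} (hg : DifferentiableAt ℝ g x) (k : Fin n) (v : E) :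
    fderiv ℝ (fun x => g x k) x v = fderiv ℝ g x v k := by
  have h := ((EuclideanSpace.proj k : EuclideanSpace ℝ (Fin n) →L[ℝ] ℝ).hasFDerivAt).comp x
    hg.hasFDerivAt
  have h2 : HasFDerivAt (fun x => g x k)
    ((EuclideanSpace.proj k : EuclideanSpace ℝ (Fin n) →L[ℝ] ℝ) ∘L fderiv ℝ g x) x := h
  rw [h2.fderiv]
  rfl

/-- Integration by parts for a `C¹` vector field and a compactly supported function. -/
lemma integral_fderiv_apply_eq {Z : EuclideanSpace ℝ (Fin n) → EuclideanSpace ℝ (Fin n)}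
    (hZ : ContDiff ℝ 1 Z) {φ : EuclideanSpace ℝ (Fin n) → ℝ} (hφ : ContDiff ℝ 1 φ)
    (hφc : HasCompactSupport φ) :
    ∫ x, fderiv ℝ φ x (Z x) = -∫ x, φ x * divergence Z x := by
  have hcoord : ∀ k, ContDiff ℝ 1 fun x => Z x k := fun k => contDiff_euclidean.1 hZ k
  have hdφ : ∀ v : EuclideanSpace ℝ (Fin n), Continuous fun x => fderiv ℝ φ x v := fun v =>
    (hφ.continuous_fderiv one_ne_zero).clm_apply continuous_const
  have hdφc : ∀ v : EuclideanSpace ℝ (Fin n), HasCompactSupport fun x => fderiv ℝ φ x v := fun v =>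
    hφc.fderiv_apply ℝ v
  have hdZ : ∀ k, Continuous fun x => fderiv ℝ (fun x => Z x k) x (EuclideanSpace.single k 1) :=
    fun k => ((hcoord k).continuous_fderiv one_ne_zero).clm_apply continuous_const
  have i1 : ∀ k, Integrable fun x => Z x k * fderiv ℝ φ x (EuclideanSpace.single k 1) := fun k =>
    ((hcoord k).continuous.mul (hdφ _)).integrable_of_hasCompactSupport (hdφc _).mul_left
  have i2 : ∀ k, Integrable fun x =>
      fderiv ℝ (fun x => Z x k) x (EuclideanSpace.single k 1) * φ x := fun k =>
    ((hdZ k).mul hφ.continuous).integrable_of_hasCompactSupport hφc.mul_left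
  have i3 : ∀ k, Integrable fun x => Z x k * φ x := fun k =>
    ((hcoord k).continuous.mul hφ.continuous).integrable_of_hasCompactSupport hφc.mul_left
  calc ∫ x, fderiv ℝ φ x (Z x)
      = ∫ x, ∑ k, Z x k * fderiv ℝ φ x (EuclideanSpace.single k 1) := by
        refine integral_congr_ae (Eventually.of_forall fun x => ?_)
        simp only
        conv_lhs => rw [EuclideanSpace.eq_sum_smul_single (Z x)]
        rw [map_sum]
        simp
    _ = ∑ k, ∫ x, Z x k * fderiv ℝ φ x (EuclideanSpace.single k 1) :=
        integral_finsetSum _ fun k _ => i1 k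
    _ = ∑ k, -∫ x, fderiv ℝ (fun x => Z x k) x (EuclideanSpace.single k 1) * φ x := by
        refine Finset.sum_congr rfl fun k _ => ?_
        exact integral_mul_fderiv_eq_neg_fderiv_mul_of_integrable (i2 k) (i1 k) (i3 k)
          (fun x _ => (hcoord k).differentiable one_ne_zero x)
          (fun x _ => hφ.differentiable one_ne_zero x)
    _ = -∫ x, φ x * divergence Z x := by
        rw [Finset.sum_neg_distrib, ← integral_finsetSum _ fun k _ => i2 k]
        congr 1
        refine integral_congr_ae (Eventually.of_forall fun x => ?_)
        simp only [divergence]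
        rw [Finset.mul_sum]
        refine Finset.sum_congr rfl fun k _ => ?_
        rw [fderiv_coord_apply (hZ.differentiable one_ne_zero x), mul_comm]

lemma divergence_sum_smul {m : ℕ}
    {X : Fin m → EuclideanSpace ℝ (Fin n) → EuclideanSpace ℝ (Fin n)}
    {b : Fin m → EuclideanSpace ℝ (Fin n) → ℝ} {x : EuclideanSpace ℝ (Fin n)}
    (hX : ∀ j, DifferentiableAt ℝ (X j) x) (hb : ∀ j, DifferentiableAt ℝ (b j) x) :
    divergence (fun x => ∑ j, b j x • X j x) x =
      ∑ j, (fderiv ℝ (b j) x (X j x) + b j x * divergence (X j) x) := by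
  have hd : HasFDerivAt (fun x => ∑ j, b j x • X j x)
      (∑ j, (b j x • fderiv ℝ (X j) x + (fderiv ℝ (b j) x).smulRight (X j x))) x :=
    HasFDerivAt.fun_sum fun j _ => (hb j).hasFDerivAt.smul (hX j).hasFDerivAt
  unfold divergence
  rw [hd.fderiv]
  simp only [FunLike.coe_sum, Finset.sum_apply, add_apply, smul_apply,
    ContinuousLinearMap.smulRight_apply, WithLp.ofLp_sum, WithLp.ofLp_add, WithLp.ofLp_smul,
    Pi.add_apply, Pi.smul_apply, smul_eq_mul]
  rw [Finset.sum_comm]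
  refine Finset.sum_congr rfl fun j _ => ?_
  rw [Finset.sum_add_distrib, Finset.mul_sum, add_comm]
  congr 1
  conv_rhs => rw [EuclideanSpace.eq_sum_smul_single (X j x), map_sum]
  simp [mul_comm]

end Divergence

/-! ### Horizontal gradients and the operator in nondivergence form. -/

section HorizontalGradient

variable {n m : ℕ} {X : Fin m → EuclideanSpace ℝ (Fin n) → EuclideanSpace ℝ (Fin n)}

lemma horizontalGradient_apply (u : EuclideanSpace ℝ (Fin n) → ℝ) (x : EuclideanSpace ℝ (Fin n))
    (j : Fin m) : horizontalGradient X u x j = fderiv ℝ u x (X j x) := rfl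

lemma sum_mul_eq_inner (a b : EuclideanSpace ℝ (Fin m)) : ∑ j, a j * b j = inner ℝ a b := by
  simp [PiLp.inner_apply, mul_comm]

lemma ContDiff.horizontalGradient (hX : ∀ j, ContDiff ℝ ∞ (X j))
    {u : EuclideanSpace ℝ (Fin n) → ℝ} (hu : ContDiff ℝ ∞ u) :
    ContDiff ℝ ∞ (horizontalGradient X u) :=
  contDiff_euclidean.2 fun j => (hu.fderiv_right (by simp)).clm_apply (hX j)

lemma continuousOn_horizontalGradient (hX : ∀ j, Continuous (X j))
    {u : EuclideanSpace ℝ (Fin n) → ℝ} {Ω : Set (EuclideanSpace ℝ (Fin n))} (hΩ : IsOpen Ω)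
    (hu : ContDiffOn ℝ 1 u Ω) : ContinuousOn (_root_.horizontalGradient X u) Ω := by
  refine (PiLp.continuous_toLp 2 _).comp_continuousOn (continuousOn_pi.2 fun j => ?_)
  exact (hu.continuousOn_fderiv_of_isOpen hΩ le_rfl).clm_apply (hX j).continuousOn

lemma horizontalGradient_eq_zero_of_notMem_tsupport (u : EuclideanSpace ℝ (Fin n) → ℝ)
    {x : EuclideanSpace ℝ (Fin n)} (hx : x ∉ tsupport u) : _root_.horizontalGradient X u x = 0 := by
  ext j
  rw [horizontalGradient_apply, image_eq_zero_of_notMem_tsupport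
    (fun h => hx (tsupport_fderiv_subset ℝ h))]
  simp

/-- A lower bound for the divergence of `∑ j, B_j(H) X_j` if `H` is a negative multiple
of `h` with coefficient decaying exponentially along `h`. -/
lemma le_divergence_of_elliptic (hX : ∀ j, ContDiff ℝ ∞ (X j))
    {B : EuclideanSpace ℝ (Fin m) → EuclideanSpace ℝ (Fin m)} (hB : ContDiff ℝ ∞ B)
    {h H : EuclideanSpace ℝ (Fin n) → EuclideanSpace ℝ (Fin m)}
    (hH : ContDiff ℝ ∞ H) {x : EuclideanSpace ℝ (Fin n)} {s α b g : ℝ} (hs : 0 ≤ s) (hα : 0 ≤ α)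
    (hderiv : ∀ j, fderiv ℝ H x (X j x) = s • (α • h x j • h x - fderiv ℝ h x (X j x)))
    (hell : ∀ v, b * ‖v‖ ^ 2 ≤ inner ℝ (fderiv ℝ B (H x) v) v ∧
      ‖fderiv ℝ B (H x) v‖ ≤ g * ‖v‖) :
    s * (α * (b * ‖h x‖ ^ 2) - g * ∑ j, ‖fderiv ℝ h x (X j x)‖) -
      ‖B (H x)‖ * ∑ j, |divergence (X j) x| ≤
      divergence (fun x => ∑ j, B (H x) j • X j x) x := by
  have hBH : ContDiff ℝ ∞ (fun x => B (H x)) := hB.comp hH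
  have hBHd : DifferentiableAt ℝ (fun x => B (H x)) x := hBH.differentiable (by simp) x
  rw [divergence_sum_smul (fun j => (hX j).differentiable (by simp) x)
    (fun j => (contDiff_euclidean.1 hBH j).differentiable (by simp) x)]
  rw [Finset.sum_add_distrib]
  have hchain : fderiv ℝ (fun x => B (H x)) x = (fderiv ℝ B (H x)) ∘L (fderiv ℝ H x) :=
    fderiv_comp x (hB.differentiable (by simp) _) (hH.differentiable (by simp) _)
  set T := fderiv ℝ B (H x) with hT
  have e1 : ∀ j, fderiv ℝ (fun x => B (H x) j) x (X j x) =
      s * (α * (T (h x) j * h x j) - T (fderiv ℝ h x (X j x)) j) := by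
    intro j
    rw [fderiv_coord_apply hBHd, hchain, ContinuousLinearMap.comp_apply, hderiv j]
    simp only [map_smul, map_sub, PiLp.smul_apply, PiLp.sub_apply, smul_eq_mul]
    ring
  -- Only the elliptic quadratic form carries the factor `α`, so a large `α` will dominate the other
  -- terms.
  have e2 : ∑ j, fderiv ℝ (fun x => B (H x) j) x (X j x) =
      s * (α * inner ℝ (T (h x)) (h x) - ∑ j, T (fderiv ℝ h x (X j x)) j) := by
    rw [Finset.sum_congr rfl fun j _ => e1 j, ← Finset.mul_sum, Finset.sum_sub_distrib,
      ← Finset.mul_sum, sum_mul_eq_inner]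
  have e3 : ∑ j, T (fderiv ℝ h x (X j x)) j ≤ g * ∑ j, ‖fderiv ℝ h x (X j x)‖ := by
    rw [Finset.mul_sum]
    refine Finset.sum_le_sum fun j _ => ?_
    exact (le_abs_self _).trans ((PiLp.norm_apply_le (T (fderiv ℝ h x (X j x))) j).trans (hell _).2)
  have e4 : -(‖B (H x)‖ * ∑ j, |divergence (X j) x|) ≤
      ∑ j, B (H x) j * divergence (X j) x := by
    rw [Finset.mul_sum, ← Finset.sum_neg_distrib]
    refine Finset.sum_le_sum fun j _ => ?_
    refine (neg_le_neg ?_).trans (neg_abs_le _)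
    rw [abs_mul]
    gcongr
    exact PiLp.norm_apply_le (B (H x)) j
  rw [e2]
  have e5 := mul_le_mul_of_nonneg_left (hell (h x)).1 hα
  have e6 : s * (α * (b * ‖h x‖ ^ 2) - g * ∑ j, ‖fderiv ℝ h x (X j x)‖) ≤
      s * (α * inner ℝ (T (h x)) (h x) - ∑ j, T (fderiv ℝ h x (X j x)) j) :=
    mul_le_mul_of_nonneg_left (by linarith) hs
  linarith

end HorizontalGradient

/-! ### Passage from pointwise to weak inequalities. -/

section Subsolutions

variable {n m : ℕ} {X : Fin m → EuclideanSpace ℝ (Fin n) → EuclideanSpace ℝ (Fin n)}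

lemma continuous_horizontalGradient (hX : ∀ j, Continuous (X j))
    {φ : EuclideanSpace ℝ (Fin n) → ℝ} (hφ : ContDiff ℝ 1 φ) :
    Continuous (horizontalGradient X φ) :=
  continuousOn_univ.1 (continuousOn_horizontalGradient hX isOpen_univ hφ.contDiffOn)

lemma HasCompactSupport.horizontalGradient {φ : EuclideanSpace ℝ (Fin n) → ℝ}
    (hφ : HasCompactSupport φ) : HasCompactSupport (horizontalGradient X φ) :=
  HasCompactSupport.intro hφ fun _ hx => horizontalGradient_eq_zero_of_notMem_tsupport φ hx

lemma integrable_mul_of_continuousOn {K : Set (EuclideanSpace ℝ (Fin n))} (hK : IsCompact K)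
    {θ φ : EuclideanSpace ℝ (Fin n) → ℝ} (hθ : ContinuousOn θ K) (hφ : Continuous φ)
    (hφK : tsupport φ ⊆ K) : Integrable fun x => θ x * φ x := by
  rw [← integrableOn_iff_integrable_of_support_subset (s := K)]
  · exact (hθ.mul hφ.continuousOn).integrableOn_compact hK
  · intro x hx
    refine hφK (subset_tsupport φ ?_)
    intro h0
    exact hx (by simp [h0])

/-- The weak form of a differential inequality, obtained from approximations for which
the inequality holds pointwise. -/
lemma integral_inner_le_of_approximation (hX : ∀ j, ContDiff ℝ ∞ (X j))
    {A : EuclideanSpace ℝ (Fin m) → EuclideanSpace ℝ (Fin m)} (hA : Continuous A)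
    {H : EuclideanSpace ℝ (Fin n) → EuclideanSpace ℝ (Fin m)} (hH : ContDiff ℝ ∞ H)
    {K : Set (EuclideanSpace ℝ (Fin n))} (hK : IsCompact K)
    {θ : EuclideanSpace ℝ (Fin n) → ℝ} (hθ : ContinuousOn θ K) {M : ℝ}
    (happrox : ∀ τ > 0, ∃ B : EuclideanSpace ℝ (Fin m) → EuclideanSpace ℝ (Fin m),
      ContDiff ℝ ∞ B ∧ (∀ x ∈ K, ‖B (H x) - A (H x)‖ ≤ τ) ∧
      ∀ x ∈ K, θ x - M * τ ≤ divergence (fun x => ∑ j, B (H x) j • X j x) x)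
    {φ : EuclideanSpace ℝ (Fin n) → ℝ} (hφ : ContDiff ℝ 1 φ) (hφc : HasCompactSupport φ)
    (hφK : tsupport φ ⊆ K) (hφ0 : ∀ x, 0 ≤ φ x) :
    ∫ x, inner ℝ (A (H x)) (horizontalGradient X φ x) ≤ -∫ x, θ x * φ x := by
  have hXc : ∀ j, Continuous (X j) := fun j => (hX j).continuous
  have hgc := continuous_horizontalGradient hXc hφ
  have hgs : HasCompactSupport (horizontalGradient X φ) := hφc.horizontalGradient
  have hint : ∀ B : EuclideanSpace ℝ (Fin m) → EuclideanSpace ℝ (Fin m), Continuous B →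
      Integrable fun x => inner ℝ (B (H x)) (horizontalGradient X φ x) := fun B hB =>
    ((hB.comp hH.continuous).inner hgc).integrable_of_hasCompactSupport
      (hgs.mono fun x hx h0 => hx (by simp only [h0, inner_zero_right]))
  have hnint : Integrable fun x => ‖horizontalGradient X φ x‖ :=
    hgc.norm.integrable_of_hasCompactSupport hgs.norm
  have hφint : Integrable φ := hφ.continuous.integrable_of_hasCompactSupport hφc
  have hθint := integrable_mul_of_continuousOn hK hθ hφ.continuous hφK
  -- Replacing `A` by `B` and integrating by parts costs an error linear in `τ`, with a coefficient
  -- depending only on `φ` and `M`.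
  have main : ∀ τ > 0, ∫ x, inner ℝ (A (H x)) (horizontalGradient X φ x) ≤
      -(∫ x, θ x * φ x) + τ * ((∫ x, ‖horizontalGradient X φ x‖) + M * ∫ x, φ x) := by
    intro τ hτ
    obtain ⟨B, hB, hBA, hdiv⟩ := happrox τ hτ
    set Z : EuclideanSpace ℝ (Fin n) → EuclideanSpace ℝ (Fin n) :=
      fun x => ∑ j, B (H x) j • X j x with hZ
    have hZc : ContDiff ℝ 1 Z := by
      have h1 : ∀ j, ContDiff ℝ 1 (X j) := fun j => (hX j).of_le (by simp)
      have h2 : ContDiff ℝ 1 fun x => B (H x) := (hB.comp hH).of_le (by simp)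
      exact ContDiff.sum fun j _ => (contDiff_euclidean.1 h2 j).smul (h1 j)
    have e1 : ∫ x, inner ℝ (A (H x)) (horizontalGradient X φ x) ≤
        ∫ x, (inner ℝ (B (H x)) (horizontalGradient X φ x) +
          τ * ‖horizontalGradient X φ x‖) := by
      refine integral_mono (hint A hA) ((hint B hB.continuous).add (hnint.const_mul τ)) fun x => ?_
      simp only
      rw [← sub_le_iff_le_add', ← inner_sub_left]
      by_cases hx : x ∈ tsupport φ
      · refine (real_inner_le_norm _ _).trans ?_
        gcongr
        rw [norm_sub_rev]
        exact hBA x (hφK hx)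
      · rw [horizontalGradient_eq_zero_of_notMem_tsupport φ hx]; simp
    rw [integral_add (hint B hB.continuous) (hnint.const_mul τ), integral_const_mul] at e1
    have e2 : ∫ x, inner ℝ (B (H x)) (horizontalGradient X φ x) = ∫ x, fderiv ℝ φ x (Z x) := by
      refine integral_congr_ae (Eventually.of_forall fun x => ?_)
      simp only
      rw [hZ, ← sum_mul_eq_inner, map_sum]
      simp [horizontalGradient_apply]
    have e3 : ∫ x, (θ x * φ x - M * τ * φ x) ≤ ∫ x, φ x * divergence Z x := by
      refine integral_mono (hθint.sub (hφint.const_mul _))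
        ((hφ.continuous.mul (continuous_divergence hZc)).integrable_of_hasCompactSupport
          hφc.mul_right) fun x => ?_
      simp only
      by_cases hx : x ∈ tsupport φ
      · have := mul_le_mul_of_nonneg_left (hdiv x (hφK hx)) (hφ0 x)
        linarith
      · rw [image_eq_zero_of_notMem_tsupport hx]; simp
    rw [integral_sub hθint (hφint.const_mul _), integral_const_mul] at e3
    rw [e2, integral_fderiv_apply_eq hZc hφ hφc] at e1
    linarith
  have hlim : Tendsto (fun τ : ℝ => -(∫ x, θ x * φ x) +
      τ * ((∫ x, ‖horizontalGradient X φ x‖) + M * ∫ x, φ x)) (𝓝[>] 0)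
      (𝓝 (-(∫ x, θ x * φ x))) := by
    have : Continuous fun τ : ℝ => -(∫ x, θ x * φ x) +
      τ * ((∫ x, ‖horizontalGradient X φ x‖) + M * ∫ x, φ x) := by fun_prop
    simpa using (this.tendsto 0).mono_left (nhdsWithin_le_nhds (s := Ioi 0))
  exact ge_of_tendsto hlim (eventually_mem_nhdsWithin.mono fun τ hτ => main τ hτ)

end Subsolutions

/-! ### The exponential barrier. -/

section Barrier

variable {n m : ℕ} {X : Fin m → EuclideanSpace ℝ (Fin n) → EuclideanSpace ℝ (Fin n)}

/-- The barrier function of Hopf's lemma, which vanishes on the sphere of radius `r`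
centered at `x₀`. -/
noncomputable def barrier (x₀ : EuclideanSpace ℝ (Fin n)) (α r ε : ℝ)
    (x : EuclideanSpace ℝ (Fin n)) : ℝ :=
  ε * (Real.exp (-(α * ‖x - x₀‖ ^ 2)) - Real.exp (-(α * r ^ 2)))

variable {x₀ : EuclideanSpace ℝ (Fin n)} {α r ε : ℝ}

lemma contDiff_normSq_sub {E : Type*} [NormedAddCommGroup E] [InnerProductSpace ℝ E] (x₀ : E) :
    ContDiff ℝ ∞ fun x : E => ‖x - x₀‖ ^ 2 :=
  (contDiff_id.sub contDiff_const).norm_sq ℝ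

lemma contDiff_barrier : ContDiff ℝ ∞ (barrier x₀ α r ε) :=
  contDiff_const.mul
    ((Real.contDiff_exp.comp (contDiff_const.mul (contDiff_normSq_sub x₀)).neg).sub contDiff_const)

lemma hasFDerivAt_exp_neg_mul_normSq (c : ℝ) (x : EuclideanSpace ℝ (Fin n)) :
    HasFDerivAt (fun x => c * Real.exp (-(α * ‖x - x₀‖ ^ 2)))
      (-(α * (c * Real.exp (-(α * ‖x - x₀‖ ^ 2)))) • fderiv ℝ (fun x => ‖x - x₀‖ ^ 2) x) x := by
  have h1 := ((contDiff_normSq_sub x₀).differentiable (by simp) x).hasFDerivAt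
  refine (((h1.const_mul α).neg.exp).const_mul c).congr_fderiv ?_
  ext v
  simp
  ring

lemma hasFDerivAt_barrier (x : EuclideanSpace ℝ (Fin n)) :
    HasFDerivAt (barrier x₀ α r ε)
      (-(ε * α * Real.exp (-(α * ‖x - x₀‖ ^ 2))) • fderiv ℝ (fun x => ‖x - x₀‖ ^ 2) x) x := by
  have h := (hasFDerivAt_exp_neg_mul_normSq (α := α) (x₀ := x₀) ε x).sub_const
    (ε * Real.exp (-(α * r ^ 2)))
  have h2 : (fun x => ε * Real.exp (-(α * ‖x - x₀‖ ^ 2)) - ε * Real.exp (-(α * r ^ 2))) =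
      barrier x₀ α r ε := by
    funext x; rw [barrier]; ring
  rw [h2] at h
  refine h.congr_fderiv ?_
  congr 1
  ring

lemma horizontalGradient_barrier (x : EuclideanSpace ℝ (Fin n)) :
    horizontalGradient X (barrier x₀ α r ε) x =
      -((ε * α * Real.exp (-(α * ‖x - x₀‖ ^ 2))) •
        horizontalGradient X (fun x => ‖x - x₀‖ ^ 2) x) := by
  ext j
  rw [horizontalGradient_apply, (hasFDerivAt_barrier x).fderiv]
  simp [horizontalGradient_apply]

lemma fderiv_horizontalGradient_barrier (hX : ∀ j, ContDiff ℝ ∞ (X j))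
    (x : EuclideanSpace ℝ (Fin n)) (j : Fin m) :
    fderiv ℝ (horizontalGradient X (barrier x₀ α r ε)) x (X j x) =
      (ε * α * Real.exp (-(α * ‖x - x₀‖ ^ 2))) •
        (α • horizontalGradient X (fun x => ‖x - x₀‖ ^ 2) x j •
          horizontalGradient X (fun x => ‖x - x₀‖ ^ 2) x -
        fderiv ℝ (horizontalGradient X (fun x => ‖x - x₀‖ ^ 2)) x (X j x)) := by
  have hh := ((ContDiff.horizontalGradient hX (contDiff_normSq_sub x₀)).differentiable
    (by simp) x).hasFDerivAt
  have h := ((hasFDerivAt_exp_neg_mul_normSq (α := α) (x₀ := x₀) (ε * α) x).fun_smul hh).fun_neg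
  have h2 : horizontalGradient X (barrier x₀ α r ε) = fun x =>
      -((ε * α * Real.exp (-(α * ‖x - x₀‖ ^ 2))) •
        horizontalGradient X (fun x => ‖x - x₀‖ ^ 2) x) := funext horizontalGradient_barrier
  rw [h2, h.fderiv]
  simp only [neg_apply, add_apply, smul_apply, ContinuousLinearMap.smulRight_apply,
    horizontalGradient_apply, smul_eq_mul]
  module

/-- Near a point where the horizontal gradient of the squared distance from `x₀` does not vanish,
the barrier is a strict weak subsolution if the decay rate is large. -/
lemma StructureConditions.exists_barrier {p κ β γ C : ℝ}
    {A : EuclideanSpace ℝ (Fin m) → EuclideanSpace ℝ (Fin m)}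
    (hA : StructureConditions p κ β γ A) (hp : 1 < p) (hκ : 0 ≤ κ) (hβ : 0 < β) (hγ : 0 < γ)
    (hC : 0 < C) (hX : ∀ j, ContDiff ℝ ∞ (X j)) {K : Set (EuclideanSpace ℝ (Fin n))}
    (hK : IsCompact K) (hKne : K.Nonempty)
    (hne : ∀ x ∈ K, horizontalGradient X (fun x => ‖x - x₀‖ ^ 2) x ≠ 0) :
    ∃ α > 0, ∀ r ε, 0 < ε → ∃ θ : EuclideanSpace ℝ (Fin n) → ℝ, ContinuousOn θ K ∧
      (∀ x ∈ K, 0 ≤ barrier x₀ α r ε x →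
        C * ((κ + barrier x₀ α r ε x) ^ (p - 2) * barrier x₀ α r ε x) < θ x) ∧
      ∀ φ : EuclideanSpace ℝ (Fin n) → ℝ, ContDiff ℝ 1 φ → HasCompactSupport φ →
        tsupport φ ⊆ K → (∀ x, 0 ≤ φ x) →
        ∫ x, inner ℝ (A (horizontalGradient X (barrier x₀ α r ε) x)) (horizontalGradient X φ x) ≤
          -∫ x, θ x * φ x := by
  set h := horizontalGradient X (fun x => ‖x - x₀‖ ^ 2) with hh
  have hhs : ContDiff ℝ ∞ h := ContDiff.horizontalGradient hX (contDiff_normSq_sub x₀)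
  obtain ⟨x₁, hx₁, hmin⟩ := hK.exists_isMinOn hKne hhs.continuous.norm.continuousOn
  set c₀ := ‖h x₁‖ with hc₀
  have hc₀pos : 0 < c₀ := norm_pos_iff.2 (hne x₁ hx₁)
  have hc₀le : ∀ x ∈ K, c₀ ≤ ‖h x‖ := fun x hx => hmin hx
  obtain ⟨c₁, hc₁⟩ := hK.exists_bound_of_continuousOn hhs.continuous.continuousOn
  have hc₁pos : 0 < c₁ := hc₀pos.trans_le (hc₁ x₁ hx₁)
  obtain ⟨K₁, hK₁⟩ := hK.exists_bound_of_continuousOn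
    (f := fun x => ∑ j, ‖fderiv ℝ h x (X j x)‖) (by
      refine (continuous_finsetSum _ fun j _ => ?_).continuousOn
      exact ((hhs.continuous_fderiv (by simp)).clm_apply (hX j).continuous).norm)
  obtain ⟨K₂, hK₂⟩ := hK.exists_bound_of_continuousOn
    (f := fun x => ∑ j, |divergence (X j) x|) (by
      refine (continuous_finsetSum _ fun j _ => ?_).continuousOn
      exact (continuous_divergence ((hX j).of_le (by simp))).abs)
  have hK₁le : ∀ x ∈ K, ∑ j, ‖fderiv ℝ h x (X j x)‖ ≤ K₁ := fun x hx =>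
    (le_abs_self _).trans (hK₁ x hx)
  have hK₂le : ∀ x ∈ K, ∑ j, |divergence (X j) x| ≤ K₂ := fun x hx =>
    (le_abs_self _).trans (hK₂ x hx)
  have hK₂0 : 0 ≤ K₂ := (norm_nonneg _).trans (hK₂ x₁ hx₁)
  obtain ⟨C₁, hC₁0, hC₁⟩ := hA.exists_norm_le hκ hβ hγ hp
  set b := β / (4 ^ |p - 2| * 4 ^ |p - 2|) with hb
  set g := γ * (4 ^ |p - 2| * 4 ^ |p - 2|) with hg
  have hb0 : 0 < b := by positivity
  have hg0 : 0 < g := by positivity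
  -- The three parts absorb the derivatives of `h`, the zero-order terms from the divergences of the
  -- `X j`, and the right-hand side with `1` to spare for strictness.
  set Λ := g * K₁ + K₂ * (C₁ * c₁) + (C * c₁ + 1) with hΛ
  -- The first entry gives `α * ‖h‖ ≥ 1`, which makes the barrier at most the norm of its horizontal
  -- gradient; the second makes ellipticity beat `Λ`. Neither depends on `r` or `ε`, so `ε` can be
  -- fixed afterwards from the boundary values.
  set α := max (1 / c₀) (Λ / (b * c₀ ^ 2)) with hα
  have hα0 : 0 < α := lt_max_of_lt_left (by positivity)
  have hα1 : 1 ≤ α * c₀ := by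
    have : 1 / c₀ ≤ α := le_max_left _ _
    rwa [div_le_iff₀ hc₀pos] at this
  have hα2 : Λ ≤ α * (b * c₀ ^ 2) := by
    have : Λ / (b * c₀ ^ 2) ≤ α := le_max_right _ _
    rwa [div_le_iff₀ (by positivity)] at this
  refine ⟨α, hα0, fun r ε hε => ?_⟩
  set H := horizontalGradient X (barrier x₀ α r ε) with hH
  have hHs : ContDiff ℝ ∞ H := ContDiff.horizontalGradient hX contDiff_barrier
  set s : EuclideanSpace ℝ (Fin n) → ℝ := fun x => ε * α * Real.exp (-(α * ‖x - x₀‖ ^ 2)) with hs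
  have hs0 : ∀ x, 0 < s x := fun x => by positivity
  have hHeq : ∀ x, H x = -(s x • h x) := fun x => horizontalGradient_barrier x
  have hHnorm : ∀ x, ‖H x‖ = s x * ‖h x‖ := fun x => by
    rw [hHeq, norm_neg, norm_smul, Real.norm_of_nonneg (hs0 x).le]
  have hHpos : ∀ x ∈ K, 0 < ‖H x‖ := fun x hx => by
    rw [hHnorm]; exact mul_pos (hs0 x) (hc₀pos.trans_le (hc₀le x hx))
  set W : EuclideanSpace ℝ (Fin n) → ℝ := fun x => (κ + ‖H x‖) ^ (p - 2) with hW
  have hW0 : ∀ x ∈ K, 0 < W x := fun x hx => by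
    have := hHpos x hx
    positivity
  refine ⟨fun x => s x * W x * (C * c₁ + 1), ?_, ?_, ?_⟩
  · refine ContinuousOn.mul (ContinuousOn.mul ?_ ?_) continuousOn_const
    · exact Continuous.continuousOn (by fun_prop)
    · refine ContinuousOn.rpow_const ?_ fun x hx => Or.inl (by linarith [hHpos x hx])
      exact (continuous_const.add hHs.continuous.norm).continuousOn
  · intro x hx hw0
    set w := barrier x₀ α r ε x with hw
    have hwH : w ≤ ‖H x‖ := by
      have h1 : w ≤ ε * Real.exp (-(α * ‖x - x₀‖ ^ 2)) := by
        rw [hw, barrier]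
        gcongr
        linarith [Real.exp_pos (-(α * r ^ 2))]
      refine h1.trans ?_
      rw [hHnorm, hs]
      have h2 : 1 ≤ α * ‖h x‖ := hα1.trans (by gcongr; exact hc₀le x hx)
      have h3 : 0 < ε * Real.exp (-(α * ‖x - x₀‖ ^ 2)) := by positivity
      nlinarith
    have h1 := monotoneOn_add_rpow_mul hκ hp (show w ∈ Ici 0 from hw0)
      (show ‖H x‖ ∈ Ici 0 from norm_nonneg _) hwH
    simp only at h1
    have h2 : ‖H x‖ ≤ s x * c₁ := by
      rw [hHnorm]
      exact mul_le_mul_of_nonneg_left (hc₁ x hx) (hs0 x).le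
    have h3 : 0 < s x * W x := mul_pos (hs0 x) (hW0 x hx)
    calc C * ((κ + w) ^ (p - 2) * w) ≤ C * (W x * (s x * c₁)) := by
          refine mul_le_mul_of_nonneg_left (h1.trans ?_) hC.le
          exact mul_le_mul_of_nonneg_left h2 (hW0 x hx).le
      _ < s x * W x * (C * c₁ + 1) := by linarith
  · intro φ hφ hφc hφK hφ0
    refine integral_inner_le_of_approximation hX hA.continuous hHs hK (M := K₂) ?_ ?_ hφ hφc hφK hφ0
    · refine ContinuousOn.mul (ContinuousOn.mul ?_ ?_) continuousOn_const
      · exact Continuous.continuousOn (by fun_prop)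
      · refine ContinuousOn.rpow_const ?_ fun x hx => Or.inl (by linarith [hHpos x hx])
        exact (continuous_const.add hHs.continuous.norm).continuousOn
    intro τ hτ
    -- The minimum of `‖H‖` on `K` is positive and serves as the radius outside which the
    -- approximations are elliptic.
    obtain ⟨x₂, hx₂, hmin₂⟩ := hK.exists_isMinOn hKne hHs.continuous.norm.continuousOn
    obtain ⟨R, hR⟩ := hK.exists_bound_of_continuousOn hHs.continuous.continuousOn
    obtain ⟨B, hB, hBA, hBell⟩ := hA.exists_smooth_approximation hκ hβ hγ (hHpos x₂ hx₂) hτ R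
    refine ⟨B, hB, fun x hx => hBA _ (hR x hx), fun x hx => ?_⟩
    have hell := hBell (H x) (hmin₂ hx)
    have hdiv := le_divergence_of_elliptic hX hB (h := h) hHs (hs0 x).le hα0.le
      (fun j => fderiv_horizontalGradient_barrier hX x j) hell
    refine le_trans ?_ hdiv
    have n1 : ‖B (H x)‖ ≤ C₁ * (W x * (s x * c₁)) + τ := by
      have h1 : ‖B (H x)‖ ≤ ‖A (H x)‖ + ‖B (H x) - A (H x)‖ := norm_le_norm_add_norm_sub' _ _
      have h2 := hBA _ (hR x hx)
      have h3 : ‖A (H x)‖ ≤ C₁ * (W x * (s x * c₁)) := by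
        refine (hC₁ (H x)).trans ?_
        refine mul_le_mul_of_nonneg_left (mul_le_mul_of_nonneg_left ?_ (hW0 x hx).le) hC₁0
        rw [hHnorm]
        exact mul_le_mul_of_nonneg_left (hc₁ x hx) (hs0 x).le
      linarith
    have n2 : ‖B (H x)‖ * ∑ j, |divergence (X j) x| ≤ (C₁ * (W x * (s x * c₁)) + τ) * K₂ := by
      exact mul_le_mul n1 (hK₂le x hx) (Finset.sum_nonneg fun j _ => abs_nonneg _)
        ((norm_nonneg _).trans n1)
    have hWx := (hW0 x hx).le
    have n3 : α * (b * c₀ ^ 2) * W x ≤ α * (b * W x * ‖h x‖ ^ 2) := by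
      have := hc₀le x hx
      calc α * (b * c₀ ^ 2) * W x = α * (b * W x * c₀ ^ 2) := by ring
        _ ≤ _ := by gcongr
    have n4 : g * W x * ∑ j, ‖fderiv ℝ h x (X j x)‖ ≤ g * W x * K₁ := by
      gcongr
      exact hK₁le x hx
    have n5 : Λ * W x ≤ α * (b * c₀ ^ 2) * W x := by gcongr
    have n6 : s x * (Λ * W x - g * W x * K₁) ≤
        s x * (α * (b * W x * ‖h x‖ ^ 2) - g * W x * ∑ j, ‖fderiv ℝ h x (X j x)‖) :=
      mul_le_mul_of_nonneg_left (by linarith) (hs0 x).le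
    have n7 : s x * (Λ * W x - g * W x * K₁) =
        s x * W x * (K₂ * (C₁ * c₁) + (C * c₁ + 1)) := by rw [hΛ]; ring
    have n8 : (C₁ * (W x * (s x * c₁)) + τ) * K₂ =
        s x * W x * (K₂ * (C₁ * c₁)) + K₂ * τ := by ring
    have n9 : s x * W x * (K₂ * (C₁ * c₁) + (C * c₁ + 1)) =
        s x * W x * (K₂ * (C₁ * c₁)) + s x * W x * (C * c₁ + 1) := by ring
    linarith

end Barrier

/-- Test functions must be `C¹`, so comparison uses the square of the positive part of `w - u`. -/
lemma hasDerivAt_max_zero_sq (t : ℝ) : HasDerivAt (fun t : ℝ => max t 0 ^ 2) (2 * max t 0) t := by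
  rcases lt_trichotomy t 0 with h | h | h
  · rw [max_eq_right h.le, mul_zero]
    refine (hasDerivAt_const t (0 : ℝ)).congr_of_eventuallyEq ?_
    filter_upwards [Iio_mem_nhds h] with s hs
    rw [max_eq_right (le_of_lt hs)]; simp
  · subst h
    rw [max_self, mul_zero, hasDerivAt_iff_isLittleO]
    refine Asymptotics.IsLittleO.of_bound fun c hc => ?_
    filter_upwards [Metric.ball_mem_nhds (0 : ℝ) hc] with s hs
    rw [Metric.mem_ball, dist_zero_right, Real.norm_eq_abs] at hs
    have h1 : max s 0 ≤ |s| := max_le (le_abs_self s) (abs_nonneg s)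
    have h2 : (0 : ℝ) ≤ max s 0 := le_max_right _ _
    simp only [max_self, sub_zero, smul_zero, Real.norm_eq_abs, ne_eq, OfNat.ofNat_ne_zero,
      not_false_eq_true, zero_pow]
    rw [abs_of_nonneg (by positivity)]
    nlinarith [abs_nonneg s]
  · rw [max_eq_left h.le]
    have := hasDerivAt_pow 2 t
    simp only [Nat.cast_ofNat, Nat.add_one_sub_one, pow_one] at this
    refine this.congr_of_eventuallyEq ?_
    filter_upwards [Ioi_mem_nhds h] with s hs
    rw [max_eq_left (le_of_lt hs)]

lemma contDiff_max_zero_sq : ContDiff ℝ 1 (fun t : ℝ => max t 0 ^ 2) := by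
  rw [contDiff_one_iff_deriv]
  refine ⟨fun t => (hasDerivAt_max_zero_sq t).differentiableAt, ?_⟩
  have : deriv (fun t : ℝ => max t 0 ^ 2) = fun t => 2 * max t 0 :=
    funext fun t => (hasDerivAt_max_zero_sq t).deriv
  rw [this]
  fun_prop

/-! ### Comparison principle and Hopf's lemma. -/

section Comparison

variable {n m : ℕ} {X : Fin m → EuclideanSpace ℝ (Fin n) → EuclideanSpace ℝ (Fin n)}
  {Ω : Set (EuclideanSpace ℝ (Fin n))} {p κ β γ C : ℝ}
  {A : EuclideanSpace ℝ (Fin m) → EuclideanSpace ℝ (Fin m)}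
  {f : EuclideanSpace ℝ (Fin n) → ℝ → ℝ} {u : EuclideanSpace ℝ (Fin n) → ℝ}

/-- Comparison of a nonnegative weak solution with a strict weak subsolution in a ball. -/
lemma IsWeakSolution.le_of_strict_subsolution (hu : IsWeakSolution Ω X A f u) (hΩ : IsOpen Ω)
    (hX : ∀ j, ContDiff ℝ ∞ (X j)) (hA : StructureConditions p κ β γ A) (hp : 1 < p)
    (hκ : 0 ≤ κ) (hβ : 0 < β) (hC : 0 < C)
    (hf : ∀ x ∈ Ω, ∀ s : ℝ, |f x s| ≤ C * (κ + |s|) ^ (p - 2) * |s|)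
    (hu_reg : ContDiffOn ℝ 1 u Ω) (hu_nonneg : ∀ x ∈ Ω, 0 ≤ u x)
    {y : EuclideanSpace ℝ (Fin n)} {ρ : ℝ} (hK : Metric.closedBall y ρ ⊆ Ω)
    {w θ : EuclideanSpace ℝ (Fin n) → ℝ} (hw : ContDiff ℝ ∞ w)
    (hbdry : ∀ x ∈ Metric.sphere y ρ, w x < u x) (hθ : ContinuousOn θ (Metric.closedBall y ρ))
    (hwθ : ∀ x ∈ Metric.closedBall y ρ, 0 ≤ w x → C * ((κ + w x) ^ (p - 2) * w x) < θ x)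
    (hsub : ∀ φ : EuclideanSpace ℝ (Fin n) → ℝ, ContDiff ℝ 1 φ → HasCompactSupport φ →
        tsupport φ ⊆ Metric.closedBall y ρ → (∀ x, 0 ≤ φ x) →
        ∫ x, inner ℝ (A (horizontalGradient X w x)) (horizontalGradient X φ x) ≤
          -∫ x, θ x * φ x) :
    ∀ x ∈ Metric.ball y ρ, w x ≤ u x := by
  set K := Metric.closedBall y ρ with hKdef
  have hKc : IsCompact K := isCompact_closedBall y ρ
  have hXc : ∀ j, Continuous (X j) := fun j => (hX j).continuous
  have hw1 : ContDiff ℝ 1 w := hw.of_le (by simp)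
  have huK : ContinuousOn u K := hu_reg.continuousOn.mono hK
  set T := {x ∈ K | u x ≤ w x} with hT
  have hTclosed : IsClosed T := hKc.isClosed.isClosed_le huK hw.continuous.continuousOn
  have hTc : IsCompact T := hKc.of_isClosed_subset hTclosed (sep_subset _ _)
  have hTball : T ⊆ Metric.ball y ρ := by
    intro x hx
    refine lt_of_le_of_ne (Metric.mem_closedBall.1 hx.1) fun hxs => ?_
    exact absurd (hbdry x hxs) (not_lt.2 hx.2)
  have hTΩ : T ⊆ Ω := fun x hx => hK hx.1
  have hballΩ : Metric.ball y ρ ⊆ Ω := Metric.ball_subset_closedBall.trans hK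
  -- Cutting off at the sphere causes no loss of regularity: `w < u` there, so the support lies in
  -- the compact set `T` inside the open ball.
  set φ : EuclideanSpace ℝ (Fin n) → ℝ :=
    (Metric.ball y ρ).indicator fun x => max (w x - u x) 0 ^ 2 with hφ
  have hφball : ∀ x ∈ Metric.ball y ρ, φ x = max (w x - u x) 0 ^ 2 := fun x hx =>
    indicator_of_mem hx _
  have hφev : ∀ x ∈ Metric.ball y ρ, φ =ᶠ[𝓝 x] fun x => max (w x - u x) 0 ^ 2 := fun x hx => by
    filter_upwards [Metric.isOpen_ball.mem_nhds hx] with z hz using hφball z hz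
  have hφ0 : ∀ x, 0 ≤ φ x := fun x => indicator_nonneg (fun _ _ => sq_nonneg _) x
  have hφpos : ∀ x, φ x ≠ 0 → x ∈ Metric.ball y ρ ∧ u x < w x := by
    intro x hx
    have hxb : x ∈ Metric.ball y ρ := by
      by_contra h
      exact hx (indicator_of_notMem h _)
    refine ⟨hxb, ?_⟩
    by_contra! h
    rw [hφball x hxb, max_eq_right (by linarith)] at hx
    simp at hx
  have hφT : tsupport φ ⊆ T := closure_minimal (fun x hx =>
    ⟨Metric.ball_subset_closedBall (hφpos x hx).1, (hφpos x hx).2.le⟩) hTclosed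
  have hφc : HasCompactSupport φ := hTc.of_isClosed_subset (isClosed_tsupport φ) hφT
  have huat : ∀ x ∈ Metric.ball y ρ, ContDiffAt ℝ 1 u x := fun x hx =>
    hu_reg.contDiffAt (hΩ.mem_nhds (hballΩ hx))
  have hφreg : ContDiff ℝ 1 φ := by
    refine contDiff_iff_contDiffAt.2 fun x => ?_
    by_cases hx : x ∈ tsupport φ
    swap
    · exact contDiffAt_const.congr_of_eventuallyEq (notMem_tsupport_iff_eventuallyEq.1 hx)
    have hxb := hTball (hφT hx)
    refine ContDiffAt.congr_of_eventuallyEq ?_ (hφev x hxb)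
    exact contDiff_max_zero_sq.contDiffAt.comp x (hw1.contDiffAt.sub (huat x hxb))
  have hgradφ : ∀ x ∈ Metric.ball y ρ, horizontalGradient X φ x =
      (2 * max (w x - u x) 0) • (horizontalGradient X w x - horizontalGradient X u x) := by
    intro x hx
    have hd := (hasDerivAt_max_zero_sq (w x - u x)).comp_hasFDerivAt x
      ((hw1.differentiable one_ne_zero x).hasFDerivAt.sub
        ((huat x hx).differentiableAt one_ne_zero).hasFDerivAt)
    have hd2 := hd.congr_of_eventuallyEq (hφev x hx)
    ext j
    rw [horizontalGradient_apply, hd2.fderiv]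
    simp [horizontalGradient_apply]
  have hgw := continuous_horizontalGradient hXc hw1
  have hgu := continuousOn_horizontalGradient hXc hΩ hu_reg
  have hgφ := continuous_horizontalGradient hXc hφreg
  have hgφ0 : ∀ x ∉ T, horizontalGradient X φ x = 0 := fun x hx =>
    horizontalGradient_eq_zero_of_notMem_tsupport φ fun h => hx (hφT h)
  have hφ00 : ∀ x ∉ T, φ x = 0 := fun x hx =>
    image_eq_zero_of_notMem_tsupport fun h => hx (hφT h)
  have int_w : Integrable fun x =>
      inner ℝ (A (horizontalGradient X w x)) (horizontalGradient X φ x) := by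
    rw [← integrableOn_iff_integrable_of_support_subset (s := T)]
    · exact ((hA.continuous.comp hgw).inner hgφ).continuousOn.integrableOn_compact hTc
    · intro x hx
      by_contra h
      exact hx (by simp only [hgφ0 x h, inner_zero_right])
  have int_u : Integrable fun x =>
      inner ℝ (A (horizontalGradient X u x)) (horizontalGradient X φ x) := by
    rw [← integrableOn_iff_integrable_of_support_subset (s := T)]
    · exact ((hA.continuous.comp_continuousOn (hgu.mono hTΩ)).inner
        hgφ.continuousOn).integrableOn_compact hTc
    · intro x hx
      by_contra h
      exact hx (by simp only [hgφ0 x h, inner_zero_right])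
  have int_f : Integrable fun x => f x (u x) * φ x := by
    rw [← integrableOn_iff_integrable_of_support_subset (s := T)]
    · exact (hu.locallyIntegrable_rhs.integrableOn_compact_subset hTΩ hTc).mul_continuousOn
        hφreg.continuous.continuousOn hTc
    · intro x hx
      by_contra h
      exact hx (by simp only [hφ00 x h, mul_zero])
  have int_θ := integrable_mul_of_continuousOn hKc hθ hφreg.continuous
    (hφT.trans (sep_subset _ _))
  have eq_u : ∫ x, inner ℝ (A (horizontalGradient X u x)) (horizontalGradient X φ x) =
      ∫ x, f x (u x) * φ x := by
    have h := hu.equation φ hφreg hφc (hφT.trans hTΩ)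
    simp only [sum_mul_eq_inner] at h
    rwa [setIntegral_eq_integral_of_forall_compl_eq_zero fun x hx => by
        rw [hgφ0 x fun h => hx (hTΩ h), inner_zero_right],
      setIntegral_eq_integral_of_forall_compl_eq_zero fun x hx => by
        rw [hφ00 x fun h => hx (hTΩ h), mul_zero]] at h
  have mono : ∫ x, inner ℝ (A (horizontalGradient X u x)) (horizontalGradient X φ x) ≤
      ∫ x, inner ℝ (A (horizontalGradient X w x)) (horizontalGradient X φ x) := by
    refine integral_mono int_u int_w fun x => ?_
    simp only
    rw [← sub_nonneg, ← inner_sub_left]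
    by_cases hx : x ∈ T
    · rw [hgradφ x (hTball hx), inner_smul_right]
      exact mul_nonneg (by positivity) (hA.inner_sub_nonneg hκ hβ _ _)
    · rw [hgφ0 x hx, inner_zero_right]
  -- Where `0 ≤ u < w`, the growth of `f` and monotonicity of the weight give `|f x (u x)| ≤ C (κ +
  -- w) ^ (p - 2) w < θ x`. Monotonicity of `A` gives an integral `≤ 0` of `(f x (u x) + θ x) φ x`,
  -- so `φ` must vanish.
  have hpt : ∀ x, φ x ≠ 0 → 0 < f x (u x) + θ x := by
    intro x hx
    obtain ⟨hxb, hlt⟩ := hφpos x hx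
    have hxK : x ∈ K := Metric.ball_subset_closedBall hxb
    have hu0 := hu_nonneg x (hK hxK)
    have h1 := hwθ x hxK (hu0.trans hlt.le)
    have h2 := hf x (hK hxK) (u x)
    rw [abs_of_nonneg hu0, mul_assoc] at h2
    have h3 := monotoneOn_add_rpow_mul hκ hp (show u x ∈ Ici 0 from hu0)
      (show w x ∈ Ici 0 from hu0.trans hlt.le) hlt.le
    have h4 := mul_le_mul_of_nonneg_left h3 hC.le
    have h5 := neg_abs_le (f x (u x))
    simp only at h4
    linarith
  have hle : ∫ x, (f x (u x) * φ x + θ x * φ x) ≤ 0 := by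
    rw [integral_add int_f int_θ]
    have := hsub φ hφreg hφc (hφT.trans (sep_subset _ _)) hφ0
    linarith
  have hnn : ∀ x, 0 ≤ f x (u x) * φ x + θ x * φ x := by
    intro x
    rcases eq_or_ne (φ x) 0 with h | h
    · simp [h]
    · rw [← add_mul]; exact mul_nonneg (hpt x h).le (hφ0 x)
  have hzero : (fun x => f x (u x) * φ x + θ x * φ x) =ᵐ[volume] 0 :=
    (integral_eq_zero_iff_of_nonneg hnn (int_f.add int_θ)).1
      (le_antisymm hle (integral_nonneg hnn))
  have hφae : φ =ᵐ[volume] 0 := by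
    filter_upwards [hzero] with x hx
    by_contra h
    simp only [Pi.zero_apply] at hx h
    rw [← add_mul] at hx
    exact (mul_ne_zero (hpt x h).ne' h) hx
  have hφz : φ = 0 := hφreg.continuous.ae_eq_iff_eq volume continuous_const |>.1 hφae
  intro x hx
  have h := hφball x hx
  rw [hφz, Pi.zero_apply] at h
  have h2 : max (w x - u x) 0 = 0 := by
    rw [← sq_eq_zero_iff]; exact h.symm
  linarith [le_max_left (w x - u x) 0]

/-- Hopf's lemma: the vector fields are tangent to the zero set of a nonnegative solution. -/
lemma IsWeakSolution.isTangentField_zeros (hu : IsWeakSolution Ω X A f u) (hΩ : IsOpen Ω)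
    (hX : ∀ j, ContDiff ℝ ∞ (X j)) (hA : StructureConditions p κ β γ A) (hp : 1 < p)
    (hκ : 0 ≤ κ) (hβ : 0 < β) (hγ : 0 < γ) (hC : 0 < C)
    (hf : ∀ x ∈ Ω, ∀ s : ℝ, |f x s| ≤ C * (κ + |s|) ^ (p - 2) * |s|)
    (hu_reg : ContDiffOn ℝ 1 u Ω) (hu_nonneg : ∀ x ∈ Ω, 0 ≤ u x) (j : Fin m) :
    IsTangentField {x ∈ Ω | u x = 0} (X j) := by
  intro y hy ν hν
  by_contra hj
  obtain ⟨σ, hσ⟩ := hν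
  rw [eventually_nhdsWithin_iff] at hσ
  -- Shortening `ν` until `2 * t * σ < 1` makes the closed ball about `x₀` through `y` meet the zero
  -- set, near `y`, only at `y`.
  set t : ℝ := 1 / (2 * |σ| + 2) with ht
  have ht0 : 0 < t := by positivity
  have htσ : 2 * t * σ < 1 := by
    have h1 : 2 * t * σ ≤ 2 * t * |σ| := by gcongr; exact le_abs_self σ
    have h2 : t * (2 * |σ| + 2) = 1 := by rw [ht]; field_simp
    linarith
  set x₀ := y + t • ν with hx₀
  set r := ‖t • ν‖ with hr
  have hyx₀ : y - x₀ = -(t • ν) := by rw [hx₀]; abel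
  set h := horizontalGradient X (fun x => ‖x - x₀‖ ^ 2) with hh
  have hhs : ContDiff ℝ ∞ h := ContDiff.horizontalGradient hX (contDiff_normSq_sub x₀)
  have hhy : h y ≠ 0 := by
    intro h0
    have h1 : h y j = 0 := by rw [h0]; rfl
    have h2 : HasFDerivAt (fun x => ‖x - x₀‖ ^ 2) _ y := ((hasFDerivAt_id y).sub_const x₀).norm_sq
    rw [hh, horizontalGradient_apply, h2.fderiv] at h1
    simp only [id, hyx₀] at h1
    simp only [smul_apply, ContinuousLinearMap.comp_apply, ContinuousLinearMap.id_apply,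
      innerSL_apply_apply, inner_neg_left, inner_smul_left, conj_trivial] at h1
    rw [real_inner_comm] at h1
    refine hj ?_
    have : t * inner ℝ (X j y) ν = 0 := by
      simp only [nsmul_eq_mul] at h1
      push_cast at h1
      linarith
    exact (mul_eq_zero.1 this).resolve_left ht0.ne'
  obtain ⟨ρ₁, hρ₁, hball⟩ := Metric.eventually_nhds_iff.1
    ((hσ.and (hΩ.mem_nhds hy.1)).and (hhs.continuous.continuousAt.eventually_ne hhy))
  set ρ := ρ₁ / 2 with hρ
  have hρ0 : 0 < ρ := by positivity
  have hin : ∀ x ∈ Metric.closedBall y ρ, dist x y < ρ₁ := fun x hx =>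
    lt_of_le_of_lt hx (by linarith)
  have hK : Metric.closedBall y ρ ⊆ Ω := fun x hx => (hball (hin x hx)).1.2
  have hext : ∀ x ∈ Metric.closedBall y ρ, x ≠ y → ‖x - x₀‖ ≤ r → 0 < u x := by
    intro x hx hxy hxr
    refine lt_of_le_of_ne (hu_nonneg x (hK hx)) fun h0 => ?_
    have h1 := (hball (hin x hx)).1.1 ⟨hK hx, h0.symm⟩
    have h2 : ‖x - x₀‖ ^ 2 = ‖x - y‖ ^ 2 - 2 * (t * inner ℝ ν (x - y)) + r ^ 2 := by
      rw [show x - x₀ = (x - y) - t • ν by rw [hx₀]; abel, norm_sub_sq_real, inner_smul_right,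
        real_inner_comm]
    have h3 : 0 < ‖x - y‖ := norm_pos_iff.2 (sub_ne_zero.2 hxy)
    have h4 : ‖x - x₀‖ ^ 2 ≤ r ^ 2 := by gcongr
    have h5 : t * inner ℝ ν (x - y) ≤ t * (σ * ‖x - y‖ ^ 2) := by gcongr
    nlinarith [mul_pos h3 h3]
  obtain ⟨α, hα, hbar⟩ := hA.exists_barrier (x₀ := x₀) hp hκ hβ hγ hC hX
    (isCompact_closedBall y ρ) ⟨y, by simp [hρ0.le]⟩ (fun x hx => (hball (hin x hx)).2)
  set S := Metric.sphere y ρ ∩ Metric.closedBall x₀ r with hS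
  have hSc : IsCompact S := (isCompact_sphere y ρ).inter_right Metric.isClosed_closedBall
  -- On `S`, a compact set where `u > 0`, the barrier is below `ε`; on the rest of the sphere it is
  -- negative.
  obtain ⟨ε, hε, hεS⟩ : ∃ ε > 0, ∀ x ∈ S, ε ≤ u x := by
    rcases S.eq_empty_or_nonempty with hemp | hne
    · exact ⟨1, one_pos, fun x hx => by rw [hemp] at hx; exact hx.elim⟩
    obtain ⟨z, hz, hmin⟩ := hSc.exists_isMinOn hne
      (hu_reg.continuousOn.mono fun x hx => hK (Metric.sphere_subset_closedBall hx.1))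
    refine ⟨u z, hext z (Metric.sphere_subset_closedBall hz.1) ?_ ?_, fun x hx => hmin hx⟩
    · intro h
      have h1 := hz.1
      rw [h, Metric.mem_sphere, dist_self] at h1
      linarith
    · rw [← dist_eq_norm]; exact hz.2
  obtain ⟨θ, hθc, hwθ, hsub⟩ := hbar r ε hε
  set w := barrier x₀ α r ε with hw
  have hbdry : ∀ x ∈ Metric.sphere y ρ, w x < u x := by
    intro x hx
    by_cases hxr : ‖x - x₀‖ ≤ r
    · refine lt_of_lt_of_le ?_ (hεS x ⟨hx, by rwa [Metric.mem_closedBall, dist_eq_norm]⟩)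
      rw [hw, barrier]
      have h1 : Real.exp (-(α * ‖x - x₀‖ ^ 2)) ≤ 1 := Real.exp_le_one_iff.2 (by
        have : 0 ≤ α * ‖x - x₀‖ ^ 2 := by positivity
        linarith)
      have h2 := Real.exp_pos (-(α * r ^ 2))
      nlinarith
    · push Not at hxr
      refine lt_of_lt_of_le ?_ (hu_nonneg x (hK (Metric.sphere_subset_closedBall hx)))
      rw [hw, barrier]
      refine mul_neg_of_pos_of_neg hε (sub_neg.2 (Real.exp_lt_exp.2 ?_))
      have : r ^ 2 < ‖x - x₀‖ ^ 2 := pow_lt_pow_left₀ hxr (norm_nonneg _) two_ne_zero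
      nlinarith
  have hle := hu.le_of_strict_subsolution hΩ hX hA hp hκ hβ hC hf hu_reg hu_nonneg hK
    contDiff_barrier hbdry hθc hwθ hsub
  have hudiff : DifferentiableAt ℝ u y :=
    (hu_reg.contDiffAt (hΩ.mem_nhds hy.1)).differentiableAt one_ne_zero
  have hwy : w y = 0 := by
    rw [hw, barrier, hyx₀, norm_neg, ← hr, sub_self, mul_zero]
  have hmin_u : IsLocalMin u y := by
    filter_upwards [hΩ.mem_nhds hy.1] with x hx
    rw [hy.2]; exact hu_nonneg x hx
  have hmin_uw : IsLocalMin (fun x => u x - w x) y := by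
    filter_upwards [Metric.ball_mem_nhds y hρ0] with x hx
    rw [hy.2, hwy]
    linarith [hle x hx]
  -- Since `u` and `u - w` both have a local minimum at `y`, the derivative of `w` vanishes there.
  have hd := hmin_uw.fderiv_eq_zero
  rw [fderiv_fun_sub hudiff (contDiff_barrier.differentiable (by simp) y),
    hmin_u.fderiv_eq_zero, zero_sub, neg_eq_zero] at hd
  have hgw : horizontalGradient X w y = 0 := by
    ext i
    rw [horizontalGradient_apply, hd]
    rfl
  rw [hw, horizontalGradient_barrier, neg_eq_zero, smul_eq_zero] at hgw
  rcases hgw with h1 | h1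
  · have : 0 < ε * α * Real.exp (-(α * ‖y - x₀‖ ^ 2)) := by positivity
    exact this.ne' h1
  · exact hhy h1

end Comparison

/-! ### The strong maximum principle. -/

theorem theorem1p2 {n m : ℕ}
    (Ω : Set (EuclideanSpace ℝ (Fin n))) (hΩ_open : IsOpen Ω) (hΩ_conn : IsConnected Ω)
    (X : Fin m → EuclideanSpace ℝ (Fin n) → EuclideanSpace ℝ (Fin n))
    (hX_smooth : ∀ j, ContDiff ℝ ∞ (X j)) (hX_rank : HormanderCondition Ω X)
    (p κ β γ : ℝ) (hp : 1 < p) (hκ : 0 ≤ κ) (hβ : 0 < β) (hγ : 0 < γ)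
    (A : EuclideanSpace ℝ (Fin m) → EuclideanSpace ℝ (Fin m))
    (hA : StructureConditions p κ β γ A)
    (f : EuclideanSpace ℝ (Fin n) → ℝ → ℝ)
    (hf_mono : ∀ x ∈ Ω, Antitone (f x))
    (C : ℝ) (hC : 0 < C)
    (hf_growth : ∀ x ∈ Ω, ∀ s : ℝ, |f x s| ≤ C * (κ + |s|) ^ (p - 2) * |s|)
    (u : EuclideanSpace ℝ (Fin n) → ℝ) (hu_reg : ContDiffOn ℝ 1 u Ω)
    (hu_sol : IsWeakSolution Ω X A f u) (hu_nonneg : ∀ x ∈ Ω, 0 ≤ u x) :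
    (∀ x ∈ Ω, u x = 0) ∨ (∀ x ∈ Ω, 0 < u x) := by
  set F := {x ∈ Ω | u x = 0} with hF
  rcases F.eq_empty_or_nonempty with hemp | hne
  · right
    intro x hx
    refine lt_of_le_of_ne (hu_nonneg x hx) fun h => ?_
    have : x ∈ F := ⟨hx, h.symm⟩
    rw [hemp] at this
    exact this
  left
  have hFΩ : F ⊆ Ω := sep_subset _ _
  -- `F` is closed only relative to `Ω`, so nearest points are sought in balls contained in `Ω`.
  have hcompact : ∀ y ∈ F, ∃ R > 0, ∀ r ≤ R, IsCompact (F ∩ Metric.closedBall y r) := by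
    intro y hy
    obtain ⟨R, hR, hball⟩ := Metric.nhds_basis_closedBall.mem_iff.1 (hΩ_open.mem_nhds hy.1)
    refine ⟨R, hR, fun r hr => ?_⟩
    have hsub : Metric.closedBall y r ⊆ Ω := (Metric.closedBall_subset_closedBall hr).trans hball
    have heq : F ∩ Metric.closedBall y r = Metric.closedBall y r ∩ u ⁻¹' {0} := by
      ext x
      exact ⟨fun h => ⟨h.2, h.1.2⟩, fun h => ⟨⟨hsub h.1, h.2⟩, h.1⟩⟩
    rw [heq]
    exact (isCompact_closedBall y r).of_isClosed_subset
      ((hu_reg.continuousOn.mono hsub).preimage_isClosed_of_isClosed Metric.isClosed_closedBall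
        isClosed_singleton) inter_subset_left
  have hopen : IsOpen (Ω \ F) := by
    have heq : Ω \ F = Ω ∩ u ⁻¹' {0}ᶜ := by
      ext x
      simp only [hF, Set.mem_sdiff, mem_ofPred_eq, mem_inter_iff, mem_preimage, mem_compl_iff,
        mem_singleton_iff]
      tauto
    rw [heq]
    exact hu_reg.continuousOn.isOpen_inter_preimage hΩ_open isOpen_compl_singleton
  have htangent : ∀ j, IsTangentField F (X j) := fun j =>
    hu_sol.isTangentField_zeros hΩ_open hX_smooth hA hp hκ hβ hγ hC hf_growth hu_reg hu_nonneg j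
  have hFeq : F = Ω := eq_of_forall_isProximalNormal_eq_zero hΩ_conn hFΩ hne hopen hcompact
    fun y hy ν hν => HormanderCondition.eq_zero_of_isProximalNormal hX_smooth hX_rank hFΩ hcompact
      htangent hy hν
  intro x hx
  rw [← hFeq] at hx
  exact hx.2
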